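/- Let $0<\alpha<1$ and let $k\ge 1$ be an integer; powers are principal branches. A $(k-1,k)$-Padé approximant of $w\mapsto w^{-\alpha}$ centred at $w=1$ is a rational function $R=p/q$ with polynomials $p,q$ over $\mathbb{C}$ satisfying $\deg p\le k-1$, $\deg q\le k$, $q(1)\neq 0$ and $w^{-\alpha}-p(w)/q(w)=O\big((w-1)^{2k}\big)$ as $w\to 1$ (equivalently, $R(1-z)$ is the $(k-1,k)$-Padé approximant of $(1-z)^{-\alpha}$ centred at $z=0$). Such $p,q$ exist, and every such pair satisfies the following, with $R_{k-1,k}=p/q$. (1) For every $z\in\mathbb{C}\setminus[1,\infty)$ with $z\ne 0$ one has $q(1-z)\neq 0$, ${}_2F_1(-k,k;\alpha;z^{-1})\neq 0$ and $$(1-z)^{-\alpha}-R_{k-1,k}(1-z)=\frac{\Gamma(k+1-\alpha)\,\Gamma(k+1)}{\Gamma(1-\alpha)\,\Gamma(2k+1)}\;\frac{{}_2F_1(k+1,k+\alpha;2k+1;z)}{{}_2F_1(-k,k;\alpha;z^{-1})}\,(-z)^k .$$ Here ${}_2F_1(-k,k;\alpha;\cdot)$ is the polynomial given by the terminating Gauss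 series, and ${}_2F_1(k+1,k+\alpha;2k+1;\cdot)$ is the analytic continuation of the Gauss series from the unit disc to $\mathbb{C}\setminus[1,\infty)$. (2) For all $\tau>0$ and $\lambda>0$, $$\lambda^{-\alpha}=\frac{2\sin(\alpha\pi)\,\tau^{1-\alpha}}{\pi}\int_{-1}^{1}(1-t)^{-\alpha}(1+t)^{\alpha-1}\;\frac{1}{1+t}\Big(\tau\frac{1-t}{1+t}+\lambda\Big)^{-1}dt .$$ There exists a $k$-point Gauss–Jacobi rule for the weight $(1-t)^{-\alpha}(1+t)^{\alpha-1}$ on $(-1,1)$, that is, distinct nodes $\vartheta_1,\dots,\vartheta_k\in(-1,1)$ and weights $w_1,\dots,w_k\in\mathbb{R}$ for which the quadrature is exact on all real polynomials of degree at most $2k-1$. For every such rule, every $\tau>0$ and every $\lambda\in\mathbb{C}\setminus(-\infty,0]$, applying the rule to the integral above yields the Padé approximant: $$\sum_{j=1}^{k}\gamma_j(\eta_j+\lambda)^{-1}=\tau^{-\alpha}R_{k-1,k}(\lambda/\tau),\qquad \gamma_j=\frac{2\sin(\alpha\pi)\,\tau^{1-\alpha}}{\pi}\,\frac{w_j}{1+\vartheta_j},\quad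 \eta_j=\frac{\tau(1-\vartheta_j)}{1+\vartheta_j}.$$ -/

import Mathlib

open Polynomial Asymptotics Topology

/-- `(p, q)` is an `(m, n)`-Padé pair for `f` at the centre `x₀`: `deg p ≤ m`, `deg q ≤ n`,
`q x₀ ≠ 0` and `f w - p w / q w = O((w - x₀) ^ (m + n + 1))` as `w → x₀`.
The `(m, n)`-Padé approximant is the rational function `p / q`. -/
structure IsPadePair (f : ℂ → ℂ) (x₀ : ℂ) (m n : ℕ) (p q : ℂ[X]) : Prop where
  natDegree_num_le : p.natDegree ≤ m
  natDegree_den_le : q.natDegree ≤ n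
  den_ne_zero : q.eval x₀ ≠ 0
  isBigO : (fun w : ℂ => f w - p.eval w / q.eval w) =O[𝓝 x₀]
    (fun w : ℂ => (w - x₀) ^ (m + n + 1))

/-- The cut plane `ℂ ∖ [1, ∞)`. -/
def cutPlane : Set ℂ := {z | 1 - z ∈ Complex.slitPlane}

/-- `F` is the principal branch of the Gauss hypergeometric function: it is holomorphic on
`ℂ ∖ [1, ∞)` and is the sum of the Gauss series in the open unit disc. -/
def IsHypergeometricBranch (a b c : ℂ) (F : ℂ → ℂ) : Prop :=
  DifferentiableOn ℂ F cutPlane ∧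
    ∀ z : ℂ, ‖z‖ < 1 → F z = ordinaryHypergeometric a b c z

/-- The principal branch is unique on the cut plane. -/
theorem IsHypergeometricBranch.eqOn {a b c : ℂ} {F G : ℂ → ℂ}
    (hF : IsHypergeometricBranch a b c F) (hG : IsHypergeometricBranch a b c G) :
    Set.EqOn F G cutPlane := by
  have hopen : IsOpen cutPlane :=
    Complex.isOpen_slitPlane.preimage (continuous_const.sub continuous_id)
  have hconn : IsPreconnected cutPlane := by
    have h : cutPlane = (fun z : ℂ => 1 - z) '' Complex.slitPlane := by
      ext z
      constructor
      · intro hz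
        exact ⟨1 - z, hz, by simp⟩
      · rintro ⟨w, hw, rfl⟩
        simpa [cutPlane] using hw
    rw [h]
    exact (Complex.starConvex_one_slitPlane.isPathConnected (by simp)).isConnected.isPreconnected.image _
      (continuous_const.sub continuous_id).continuousOn
  have h0 : (0 : ℂ) ∈ cutPlane := by simp [cutPlane]
  refine (hF.1.analyticOnNhd hopen).eqOn_of_preconnected_of_eventuallyEq
    (hG.1.analyticOnNhd hopen) hconn h0 ?_
  filter_upwards [Metric.ball_mem_nhds (0 : ℂ) one_pos] with z hz
  have hz' : ‖z‖ < 1 := by simpa using hz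
  rw [hF.2 z hz', hG.2 z hz']

open Classical in
/-- The Gauss hypergeometric function `₂F₁(a, b; c; z)`: if `a` or `b` is a nonpositive integer,
the series terminates and is a polynomial in `z`, valid for all `z`; otherwise the analytic
continuation of the Gauss series from the unit disc to `ℂ ∖ [1, ∞)`, evaluated at `z`. -/
noncomputable def hyp2F1 (a b c z : ℂ) : ℂ :=
  if ∃ n : ℕ, a = -(n : ℂ) ∨ b = -(n : ℂ) then ordinaryHypergeometric a b c z
  else Classical.epsilon (IsHypergeometricBranch a b c) z

/-- The Jacobi weight `(1 - t) ^ (-α) * (1 + t) ^ (α - 1)` on `(-1, 1)`. -/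
noncomputable def jacobiWeight (α t : ℝ) : ℝ := (1 - t) ^ (-α) * (1 + t) ^ (α - 1)

/-- `θ` and `w` are the nodes and weights of the `k`-point Gauss–Jacobi rule for
`jacobiWeight α`: `k` distinct nodes in `(-1, 1)`, exact on polynomials of degree `≤ 2k - 1`. -/
structure IsGaussJacobiRule (α : ℝ) (k : ℕ) (θ w : Fin k → ℝ) : Prop where
  injective : Function.Injective θ
  mem_Ioo : ∀ j, θ j ∈ Set.Ioo (-1 : ℝ) 1
  exact_of_lt : ∀ P : ℝ[X], P.natDegree < 2 * k →
    ∑ j, w j * P.eval (θ j) = ∫ t in (-1 : ℝ)..1, jacobiWeight α t * P.eval t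

/-- `2 sin(α π) τ^(1-α) / π`, the factor in front of the integral. -/
noncomputable def quadConst (α τ : ℝ) : ℝ :=
  2 * Real.sin (α * Real.pi) * τ ^ (1 - α) / Real.pi

/-- The factor `(1 + t)⁻¹ (τ (1 - t) / (1 + t) + l)⁻¹` which multiplies the Jacobi weight in
the integral representation of `l ^ (-α)`. -/
noncomputable def quadIntegrand (τ : ℝ) (l : ℂ) (t : ℝ) : ℂ :=
  ((1 + t : ℝ) : ℂ)⁻¹ * (((τ * (1 - t) / (1 + t) : ℝ) : ℂ) + l)⁻¹

/-- The rational function of `l` obtained by applying the rule with nodes `θ` and weights `w` to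
`quadConst α τ * ∫ t in -1..1, jacobiWeight α t * quadIntegrand τ l t`; that is,
`∑ j, γ j / (η j + l)` with `γ j = quadConst α τ * w j / (1 + θ j)` and
`η j = τ (1 - θ j) / (1 + θ j)`. -/
noncomputable def quadRational (α τ : ℝ) {k : ℕ} (θ w : Fin k → ℝ) (l : ℂ) : ℂ :=
  (quadConst α τ : ℂ) * ∑ j, (w j : ℂ) * quadIntegrand τ l (θ j)

/-!
Put `w = 1 - z`. The function `(1 - z) ^ (-α)` is a Stieltjes function: its Taylor coefficients
`(α)ₙ / n!` are the moments of the beta distribution with density proportional to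
`s ^ (α - 1) * (1 - s) ^ (-α)` on `(0, 1)`. Let `Λ` be the moment functional (`momentFunctional`).

For a polynomial `Q` of degree at most `k` and its reversal `Q* z = z ^ k * Q (1 / z)`, multiplying
power series gives, for `|z| < 1`,
`(1 - z) ^ (-α) * Q* z = (polynomial of degree < k) + ∑ₙ Λ (Q Xⁿ) z ^ (n + k)`
(`hasSum_momentFunctional`). Hence `Q*` is the denominator of a Padé pair exactly when `Λ (Q Xⁿ) = 0`
for `n < k`, that is, when `Q` is the orthogonal polynomial of degree `k`, which positivity of the
weight makes unique up to a factor, with simple zeros, all in `(0, 1)`. So all Padé pairs are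
proportional, and their denominators vanish only on the cut.

The orthogonal polynomial is `₂F₁(-k, k; α; X)`. The hypergeometric differential operator is
symmetric for `Λ`, and this yields a first order recurrence for `Λ (Q Xⁿ)`
(`momentFunctional_jacobiPoly_succ`). The recurrence gives orthogonality, and it identifies the
remainder series with a multiple of the Gauss series of `₂F₁(k + 1, k + α; 2k + 1; z)`; the
multiple is found from a `k`-th finite difference. As the left-hand side is holomorphic on the cut
plane, the same identity shows that the Gauss series continues there, and it extends the remainder
formula to the cut plane.

The nodes of a Gauss–Jacobi rule, moved to `(0, 1)` by `s = (1 + t) / 2`, are the zeros of the same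
orthogonal polynomial, and the rule reproduces the moments. Applied to the Cauchy kernel
`1 / (1 - z s)`, it therefore returns the Padé approximant (`eval_padeNumerator_of_quadrature`). The
integral representation itself is a beta integral after a Möbius substitution.
-/

open Finset (range sum_congr mem_range)
open MeasureTheory

/-! ### Moments -/

/-- The moment `(a)ₙ / n!`: the coefficient of `z ^ n` in `(1 - z) ^ (-a)`, and the `n`-th moment of
the beta distribution with parameters `a` and `1 - a`. -/
noncomputable def jacobiMoment (a : ℂ) (n : ℕ) : ℂ :=
  (n.factorial : ℂ)⁻¹ * (ascPochhammer ℂ n).eval a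

theorem jacobiMoment_succ (a : ℂ) (n : ℕ) :
    ((n : ℂ) + 1) * jacobiMoment a (n + 1) = (a + n) * jacobiMoment a n := by
  have h1 : ((n : ℂ) + 1) ≠ 0 := by exact_mod_cast n.succ_ne_zero
  have h2 : (n.factorial : ℂ) ≠ 0 := by exact_mod_cast n.factorial_ne_zero
  simp only [jacobiMoment, Nat.factorial_succ, ascPochhammer_succ_eval]
  push_cast
  field_simp

theorem hasSum_jacobiMoment (a : ℂ) {z : ℂ} (hz : ‖z‖ < 1) :
    HasSum (fun n => jacobiMoment a n * z ^ n) ((1 - z) ^ (-a)) := by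
  have h := (Complex.one_div_one_sub_cpow_hasFPowerSeriesOnBall_zero a).hasSum (y := z)
    (by simpa [enorm_eq_nnnorm, ← NNReal.coe_lt_coe] using hz)
  have hm : ∀ n : ℕ, Ring.choose (a + n - 1) n = jacobiMoment a n := by
    intro n
    have h2 : (n.factorial : ℂ) ≠ 0 := by exact_mod_cast n.factorial_ne_zero
    have h3 := Ring.factorial_nsmul_multichoose_eq_ascPochhammer a n
    rw [Polynomial.ascPochhammer_smeval_eq_eval, nsmul_eq_mul] at h3
    rw [Ring.choose, jacobiMoment, ← h3, show a + n - 1 - n + 1 = a by ring]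
    field_simp
  simpa [FormalMultilinearSeries.ofScalars_apply_eq, hm, Complex.cpow_neg, mul_comm] using h

/-- The linear functional on polynomials with the moments `jacobiMoment a`. -/
noncomputable def momentFunctional (a : ℂ) : ℂ[X] →ₗ[ℂ] ℂ :=
  Polynomial.lsum fun n => (jacobiMoment a n) • LinearMap.id

@[simp]
theorem momentFunctional_X_pow (a : ℂ) (n : ℕ) :
    momentFunctional a (X ^ n) = jacobiMoment a n := by
  rw [← Polynomial.monomial_one_right_eq_X_pow]
  simp [momentFunctional, Polynomial.lsum]

theorem momentFunctional_mul_X_pow (a : ℂ) {k : ℕ} {Q : ℂ[X]} (hQ : Q.natDegree ≤ k) (n : ℕ) :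
    momentFunctional a (Q * X ^ n) = ∑ j ∈ range (k + 1), Q.coeff j * jacobiMoment a (n + j) := by
  conv_lhs => rw [Q.as_sum_range_C_mul_X_pow' (Nat.lt_succ_of_le hQ)]
  rw [Finset.sum_mul, map_sum]
  refine sum_congr rfl fun j _ => ?_
  rw [mul_assoc, ← pow_add, ← Polynomial.smul_eq_C_mul, map_smul, momentFunctional_X_pow,
    smul_eq_mul, add_comm j n]

/-! ### The Jacobi polynomial -/

/-- The polynomial `₂F₁(-k, k; a; X)`, the Jacobi polynomial on `[0, 1]` for the weight
`s ^ (a - 1) * (1 - s) ^ (-a)`, up to normalisation. -/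
noncomputable def jacobiPoly (a : ℂ) (k : ℕ) : ℂ[X] :=
  ∑ j ∈ range (k + 1), C (ordinaryHypergeometricCoefficient (-(k : ℂ)) (k : ℂ) a j) * X ^ j

theorem ordinaryHypergeometricCoefficient_eq_zero {k j : ℕ} (hj : k < j) (b c : ℂ) :
    ordinaryHypergeometricCoefficient (-(k : ℂ)) b c j = 0 := by
  simp [ordinaryHypergeometricCoefficient, ascPochhammer_eval_neg_coe_nat_of_lt hj]

theorem coeff_jacobiPoly (a : ℂ) (k j : ℕ) :
    (jacobiPoly a k).coeff j = ordinaryHypergeometricCoefficient (-(k : ℂ)) (k : ℂ) a j := by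
  simp only [jacobiPoly, Polynomial.finsetSum_coeff, Polynomial.coeff_C_mul_X_pow,
    Finset.sum_ite_eq, mem_range]
  split_ifs with h
  · rfl
  · rw [ordinaryHypergeometricCoefficient_eq_zero (by omega)]

theorem natDegree_jacobiPoly_le (a : ℂ) (k : ℕ) : (jacobiPoly a k).natDegree ≤ k := by
  rw [Polynomial.natDegree_le_iff_coeff_eq_zero]
  intro j hj
  rw [coeff_jacobiPoly, ordinaryHypergeometricCoefficient_eq_zero hj]

theorem eval_jacobiPoly (a : ℂ) (k : ℕ) (x : ℂ) :
    (jacobiPoly a k).eval x = ordinaryHypergeometric (-(k : ℂ)) (k : ℂ) a x := by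
  simp only [ordinaryHypergeometric_eq_tsum]
  rw [tsum_eq_sum (s := range (k + 1)), jacobiPoly,
    Polynomial.eval_finsetSum]
  · simp [ordinaryHypergeometricCoefficient]
  · intro j hj
    have := ordinaryHypergeometricCoefficient_eq_zero (k := k) (j := j)
      (by simpa [Nat.succ_le_iff] using hj) k a
    rw [ordinaryHypergeometricCoefficient] at this
    rw [this, zero_smul]

theorem ordinaryHypergeometricCoefficient_succ (a b c : ℂ) (n : ℕ) (hc : c + n ≠ 0) :
    ((n : ℂ) + 1) * (c + n) * ordinaryHypergeometricCoefficient a b c (n + 1) =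
      (a + n) * (b + n) * ordinaryHypergeometricCoefficient a b c n := by
  have h1 : ((n : ℂ) + 1) ≠ 0 := by exact_mod_cast n.succ_ne_zero
  have h2 : (n.factorial : ℂ) ≠ 0 := by exact_mod_cast n.factorial_ne_zero
  simp only [ordinaryHypergeometricCoefficient, Nat.factorial_succ, ascPochhammer_succ_eval]
  push_cast
  rw [mul_inv_rev, mul_inv_rev]
  field_simp

/-- The functional paired with `jacobiPoly a k` satisfies a first order recurrence in the power of
`X`. It expresses that the hypergeometric operator `X (1 - X) D² + (a - X) D` is symmetric for
`momentFunctional a` and has `jacobiPoly a k` as an eigenvector for the eigenvalue `-k²`. -/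
theorem momentFunctional_jacobiPoly_succ {a : ℂ} (ha : ∀ n : ℕ, a + n ≠ 0) (k n : ℕ) :
    (((n : ℂ) + 1) ^ 2 - (k : ℂ) ^ 2) * momentFunctional a (jacobiPoly a k * X ^ (n + 1)) =
      ((n : ℂ) + 1) * (n + a) * momentFunctional a (jacobiPoly a k * X ^ n) := by
  have hd := natDegree_jacobiPoly_le a k
  rw [momentFunctional_mul_X_pow a hd, momentFunctional_mul_X_pow a hd, Finset.mul_sum,
    Finset.mul_sum]
  simp only [coeff_jacobiPoly]
  set c := ordinaryHypergeometricCoefficient (-(k : ℂ)) (k : ℂ) a with hc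
  set m := jacobiMoment a with hm
  have hms : ∀ i : ℕ, ((i : ℂ) + 1) * m (i + 1) = (a + i) * m i := jacobiMoment_succ a
  -- both sums of shifted terms agree, because the shifted term vanishes at both ends
  have hshift : ∑ j ∈ range (k + 1), c j * (j * (j - 1 + a)) * m (n + j) =
      ∑ j ∈ range (k + 1), c (j + 1) * ((j + 1) * (j + a)) * m (n + 1 + j) := by
    have h0 : c (k + 1) = 0 := ordinaryHypergeometricCoefficient_eq_zero (Nat.lt_succ_self k) _ _
    have h1 := Finset.sum_range_succ (fun j : ℕ => c j * (j * (j - 1 + a)) * m (n + j)) (k + 1)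
    have h2 := Finset.sum_range_succ' (fun j : ℕ => c j * (j * (j - 1 + a)) * m (n + j)) (k + 1)
    rw [h1, h0] at h2
    simp only [zero_mul, add_zero, Nat.cast_zero, mul_zero] at h2
    rw [h2]
    refine sum_congr rfl fun j _ => ?_
    rw [show n + (j + 1) = n + 1 + j by ring]
    push_cast
    ring
  have key : ∑ j ∈ range (k + 1), (((n : ℂ) + 1) ^ 2 - (k : ℂ) ^ 2) * (c j * m (n + 1 + j)) -
      ∑ j ∈ range (k + 1), ((n : ℂ) + 1) * (n + a) * (c j * m (n + j)) =
      ∑ j ∈ range (k + 1), c (j + 1) * ((j + 1) * (j + a)) * m (n + 1 + j) -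
      ∑ j ∈ range (k + 1), c j * (j * (j - 1 + a)) * m (n + j) := by
    rw [← Finset.sum_sub_distrib, ← Finset.sum_sub_distrib]
    refine sum_congr rfl fun j _ => ?_
    have e1 := ordinaryHypergeometricCoefficient_succ (-(k : ℂ)) (k : ℂ) a j (ha j)
    rw [← hc] at e1
    have e2 := hms (n + j)
    rw [show n + j + 1 = n + 1 + j by ring] at e2
    push_cast at e2
    linear_combination (-m (n + 1 + j)) * e1 + ((n : ℂ) + 1 - j) * c j * e2
  rw [hshift, sub_self] at key
  exact sub_eq_zero.mp key

theorem momentFunctional_jacobiPoly_eq_zero {a : ℂ} (ha : ∀ n : ℕ, a + n ≠ 0) {k n : ℕ}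
    (hn : n < k) : momentFunctional a (jacobiPoly a k * X ^ n) = 0 := by
  -- downwards from `n + 1 = k`, where the factor `(n + 1)² - k²` vanishes
  have key : ∀ d n : ℕ, n + d + 1 = k → momentFunctional a (jacobiPoly a k * X ^ n) = 0 := by
    intro d
    induction d with
    | zero =>
      intro n h
      have h1 := momentFunctional_jacobiPoly_succ ha k n
      rw [← h] at h1 ⊢
      push_cast at h1
      have h2 : ((n : ℂ) + 1) * (n + a) ≠ 0 :=
        mul_ne_zero (by exact_mod_cast n.succ_ne_zero) (by rw [add_comm]; exact ha n)
      have h3 := h1.symm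
      simp only [add_zero, sub_self, zero_mul, mul_eq_zero] at h3
      exact h3.resolve_left (by simpa using h2)
    | succ d ih =>
      intro n h
      have h1 := momentFunctional_jacobiPoly_succ ha k n
      rw [ih (n + 1) (by omega), mul_zero] at h1
      have h2 : ((n : ℂ) + 1) * (n + a) ≠ 0 :=
        mul_ne_zero (by exact_mod_cast n.succ_ne_zero) (by rw [add_comm]; exact ha n)
      exact (mul_eq_zero.mp h1.symm).resolve_left h2
  exact key (k - 1 - n) n (by omega)

theorem momentFunctional_jacobiPoly_add {a : ℂ} (ha : ∀ n : ℕ, a + n ≠ 0) {k : ℕ} (n : ℕ) :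
    momentFunctional a (jacobiPoly a k * X ^ (n + k)) =
      momentFunctional a (jacobiPoly a k * X ^ k) *
        ordinaryHypergeometricCoefficient ((k : ℂ) + 1) ((k : ℂ) + a) (2 * (k : ℂ) + 1) n := by
  induction n with
  | zero => simp [ordinaryHypergeometricCoefficient]
  | succ n ih =>
    have h1 := momentFunctional_jacobiPoly_succ ha k (n + k)
    have h3 : (2 * (k : ℂ) + 1) + n ≠ 0 := by
      exact_mod_cast (show 2 * k + 1 + n ≠ 0 by omega)
    have h4 : (n : ℂ) + 1 ≠ 0 := by exact_mod_cast n.succ_ne_zero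
    have h2 := ordinaryHypergeometricCoefficient_succ ((k : ℂ) + 1) ((k : ℂ) + a)
      (2 * (k : ℂ) + 1) n h3
    rw [ih] at h1
    rw [show n + 1 + k = n + k + 1 by ring]
    push_cast at h1
    apply mul_left_cancel₀ (mul_ne_zero h4 h3)
    linear_combination h1 - momentFunctional a (jacobiPoly a k * X ^ k) * h2

/-! ### The norm of the Jacobi polynomial -/

/-- The `k`-th forward difference of `x ↦ x⁻¹`. -/
theorem sum_choose_mul_inv (k : ℕ) : ∀ x : ℂ, (∀ j : ℕ, x + j ≠ 0) →
    ∑ j ∈ range (k + 1), (-1 : ℂ) ^ j * (k.choose j) * (x + j)⁻¹ =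
      k.factorial * ((ascPochhammer ℂ (k + 1)).eval x)⁻¹ := by
  have hΔ : ∀ k : ℕ, ∀ x : ℂ, (∀ j : ℕ, x + j ≠ 0) → (fwdDiff 1)^[k] (fun x : ℂ => x⁻¹) x =
      (-1) ^ k * (k.factorial * ((ascPochhammer ℂ (k + 1)).eval x)⁻¹) := by
    intro k
    induction k with
    | zero => intro x _; simp
    | succ k ih =>
      intro x hx
      have hx' : ∀ j : ℕ, x + 1 + j ≠ 0 := fun j => by
        have := hx (j + 1)
        push_cast at this
        rwa [add_assoc, add_comm (1 : ℂ)]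
      rw [Function.iterate_succ_apply', fwdDiff, ih x hx, ih (x + 1) hx']
      have e1 : (ascPochhammer ℂ (k + 2)).eval x =
          x * (ascPochhammer ℂ (k + 1)).eval (x + 1) := by
        rw [ascPochhammer_succ_left]; simp
      have e2 := ascPochhammer_succ_eval (k + 1) x
      have n1 : (ascPochhammer ℂ (k + 1)).eval x ≠ 0 := by
        rw [Ne, ascPochhammer_eval_eq_zero_iff]
        rintro ⟨j, _, hj⟩
        exact hx j (by rw [hj]; ring)
      have n0 : x ≠ 0 := by simpa using hx 0
      have n2 := hx (k + 1)
      have e3 : (ascPochhammer ℂ (k + 1)).eval (x + 1) =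
          (ascPochhammer ℂ (k + 1)).eval x * (x + (k + 1 : ℕ)) / x := by
        rw [eq_div_iff n0, ← e2, e1]; ring
      rw [e3, e2, Nat.factorial_succ]
      push_cast at n2 ⊢
      field_simp
      ring
  intro x hx
  have h := hΔ k x hx
  rw [fwdDiff_iter_eq_sum_shift] at h
  have hs : ((-1 : ℂ) ^ k) * (-1) ^ k = 1 := by rw [← mul_pow]; simp
  calc _ = (-1) ^ k * ∑ j ∈ range (k + 1),
        ((-1 : ℤ) ^ (k - j) * (k.choose j : ℤ)) • (x + j • (1 : ℂ))⁻¹ := by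
        rw [Finset.mul_sum]
        refine sum_congr rfl fun j hj => ?_
        have hj' : j ≤ k := Nat.lt_succ_iff.mp (mem_range.mp hj)
        have : (-1 : ℂ) ^ k * (-1) ^ (k - j) = (-1) ^ j := by
          obtain ⟨d, rfl⟩ := Nat.exists_eq_add_of_le hj'
          rw [Nat.add_sub_cancel_left, pow_add, mul_assoc, ← mul_pow]; simp
        simp only [zsmul_eq_mul, nsmul_eq_mul, mul_one]
        push_cast
        rw [← this]; ring
    _ = _ := by rw [h, ← mul_assoc, hs, one_mul]

theorem sum_choose_mul_eval_eq_zero {k : ℕ} {g : ℂ[X]} (hg : g.natDegree < k) :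
    ∑ j ∈ range (k + 1), (-1 : ℂ) ^ j * (k.choose j) * g.eval (j : ℂ) = 0 := by
  have h := congrFun (Polynomial.fwdDiff_iter_eq_zero_of_degree_lt hg) 0
  rw [fwdDiff_iter_eq_sum_shift] at h
  have h2 := congrArg (fun y => (-1 : ℂ) ^ k * y) h
  simp only [Finset.mul_sum, Pi.zero_apply, mul_zero] at h2
  rw [← h2]
  refine sum_congr rfl fun j hj => ?_
  have hj' : j ≤ k := Nat.lt_succ_iff.mp (mem_range.mp hj)
  have : (-1 : ℂ) ^ k * (-1) ^ (k - j) = (-1) ^ j := by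
    obtain ⟨d, rfl⟩ := Nat.exists_eq_add_of_le hj'
    rw [Nat.add_sub_cancel_left, pow_add, mul_assoc, ← mul_pow]; simp
  simp only [zsmul_eq_mul, nsmul_eq_mul, mul_one, zero_add]
  push_cast
  rw [← this]; ring

/-- Dividing `g` by `X + x` leaves the remainder `g (-x)`, and the quotient, having degree less than
`k`, is annihilated by the `k`-th difference. -/
theorem sum_choose_mul_eval_mul_inv {k : ℕ} (hk : 1 ≤ k) {g : ℂ[X]} (hg : g.natDegree ≤ k) {x : ℂ}
    (hx : ∀ j : ℕ, x + j ≠ 0) :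
    ∑ j ∈ range (k + 1), (-1 : ℂ) ^ j * (k.choose j) * (g.eval (j : ℂ) * (x + j)⁻¹) =
      g.eval (-x) * (k.factorial * ((ascPochhammer ℂ (k + 1)).eval x)⁻¹) := by
  set h := g /ₘ (X - C (-x)) with hh
  have hdeg : h.natDegree < k := by
    rw [hh, Polynomial.natDegree_divByMonic _ (Polynomial.monic_X_sub_C _),
      Polynomial.natDegree_X_sub_C]
    omega
  have hdiv : ∀ y : ℂ, g.eval y = g.eval (-x) + (x + y) * h.eval y := by
    intro y
    conv_lhs => rw [← Polynomial.modByMonic_add_div g (X - C (-x)),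
      Polynomial.modByMonic_X_sub_C_eq_C_eval]
    rw [← hh]
    simp only [eval_add, eval_mul, eval_C, eval_sub, eval_X]
    ring
  rw [← sum_choose_mul_inv k x hx, Finset.mul_sum, ← sub_eq_zero, ← Finset.sum_sub_distrib,
    ← sum_choose_mul_eval_eq_zero hdeg]
  refine sum_congr rfl fun j _ => ?_
  rw [hdiv j]
  have := hx j
  field_simp
  ring

/-- A case of the Pfaff–Saalschütz sum: the squared norm of the Jacobi polynomial, divided by its
leading coefficient. -/
theorem momentFunctional_jacobiPoly_self {a : ℂ} (ha : ∀ n : ℕ, a + n ≠ 0) {k : ℕ} (hk : 1 ≤ k) :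
    momentFunctional a (jacobiPoly a k * X ^ k) =
      (-1) ^ k * (ascPochhammer ℂ k).eval (1 - a) * k.factorial / (2 * k).factorial := by
  obtain ⟨r, rfl⟩ := Nat.exists_eq_add_of_le' hk
  set k := r + 1 with hkr
  set g : ℂ[X] := (ascPochhammer ℂ k).comp (X + C a) with hg
  have hgd : g.natDegree ≤ k := by
    rw [hg, Polynomial.natDegree_comp, ascPochhammer_natDegree, Polynomial.natDegree_X_add_C,
      mul_one]
  have hrec : ∀ j : ℕ, (k : ℂ) + j ≠ 0 := fun j => by
    exact_mod_cast (show k + j ≠ 0 by omega)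
  have hr : (r.factorial : ℂ) ≠ 0 := by exact_mod_cast r.factorial_ne_zero
  have hsum := sum_choose_mul_eval_mul_inv hk hgd hrec
  have hterm : momentFunctional a (jacobiPoly a k * X ^ k) = (r.factorial : ℂ)⁻¹ *
      ∑ j ∈ range (k + 1), (-1 : ℂ) ^ j * (k.choose j) * (g.eval (j : ℂ) * ((k : ℂ) + j)⁻¹) := by
    rw [momentFunctional_mul_X_pow a (natDegree_jacobiPoly_le a k), Finset.mul_sum]
    refine sum_congr rfl fun j hj => ?_
    have hj' : j ≤ k := Nat.lt_succ_iff.mp (mem_range.mp hj)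
    have e1 : (ascPochhammer ℂ (k + j)).eval a =
        (ascPochhammer ℂ j).eval a * g.eval (j : ℂ) := by
      rw [add_comm k j, ← ascPochhammer_mul, hg]
      simp [add_comm]
    have e2 : (ascPochhammer ℂ j).eval (-(k : ℂ)) = (-1) ^ j * (j.factorial * k.choose j) := by
      rw [ascPochhammer_eval_neg_eq_descPochhammer, descPochhammer_eval_eq_descFactorial,
        Nat.descFactorial_eq_factorial_mul_choose]
      push_cast; ring
    have e3 : (r.factorial : ℂ) * (ascPochhammer ℂ j).eval (k : ℂ) = (r + j).factorial := by
      rw [hkr]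
      push_cast
      exact factorial_mul_ascPochhammer ℂ r j
    have e4 : ((k + j).factorial : ℂ) = (k + j) * (r + j).factorial := by
      rw [hkr, show r + 1 + j = (r + j) + 1 by ring, Nat.factorial_succ]
      push_cast; ring
    have n1 : (ascPochhammer ℂ j).eval a ≠ 0 := by
      rw [Ne, ascPochhammer_eval_eq_zero_iff]
      rintro ⟨i, _, hi⟩
      exact ha i (by rw [hi]; ring)
    have n2 : (j.factorial : ℂ) ≠ 0 := by exact_mod_cast j.factorial_ne_zero
    have n3 : ((r + j).factorial : ℂ) ≠ 0 := by exact_mod_cast (r + j).factorial_ne_zero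
    have n4 := hrec j
    rw [coeff_jacobiPoly, ordinaryHypergeometricCoefficient, jacobiMoment, e1, e2, e4]
    have e5 : (ascPochhammer ℂ j).eval (k : ℂ) = (r + j).factorial / r.factorial := by
      rw [eq_div_iff hr, ← e3]; ring
    rw [e5]
    field_simp
  have e6 : g.eval (-(k : ℂ)) = (-1) ^ k * (ascPochhammer ℂ k).eval (1 - a) := by
    have h := ascPochhammer_eval_neg_eq_descPochhammer (R := ℂ) ((k : ℂ) - a) k
    rw [descPochhammer_eval_eq_ascPochhammer,
      show (k : ℂ) - a - k + 1 = 1 - a by ring] at h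
    rw [hg, Polynomial.eval_comp]
    simp only [eval_add, eval_X, eval_C]
    rw [show -(k : ℂ) + a = -((k : ℂ) - a) by ring, h]
  have e7 : (r.factorial : ℂ) * (ascPochhammer ℂ (k + 1)).eval (k : ℂ) = (2 * k).factorial := by
    have := factorial_mul_ascPochhammer ℂ r (k + 1)
    rw [hkr] at this ⊢
    push_cast at this ⊢
    rw [this]
    congr 2; ring
  rw [hterm, hsum, e6, ← e7, div_eq_mul_inv, mul_inv]
  ring

/-! ### Padé pairs and orthogonality -/

/-- The polynomial part of degree less than `k` of `(1 - z) ^ (-a) * z ^ k * Q (1 / z)`. -/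
noncomputable def padeNumerator (a : ℂ) (k : ℕ) (Q : ℂ[X]) : ℂ[X] :=
  ∑ j ∈ range (k + 1), ∑ n ∈ range j, C (Q.coeff j * jacobiMoment a n) * X ^ (n + (k - j))

theorem natDegree_padeNumerator_le (a : ℂ) (k : ℕ) (Q : ℂ[X]) :
    (padeNumerator a k Q).natDegree ≤ k - 1 := by
  refine Polynomial.natDegree_sum_le_of_forall_le _ _ fun j hj =>
    Polynomial.natDegree_sum_le_of_forall_le _ _ fun n hn =>
      (Polynomial.natDegree_C_mul_X_pow_le _ _).trans ?_
  rw [mem_range] at hj hn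
  omega

theorem padeNumerator_C_mul (a : ℂ) (k : ℕ) (c : ℂ) (Q : ℂ[X]) :
    padeNumerator a k (C c * Q) = C c * padeNumerator a k Q := by
  simp only [padeNumerator, Finset.mul_sum, Polynomial.coeff_C_mul, mul_assoc, C_mul]

theorem natDegree_reflect_le_of_le {k : ℕ} {Q : ℂ[X]} (hQ : Q.natDegree ≤ k) :
    (reflect k Q).natDegree ≤ k :=
  Polynomial.natDegree_reflect_le.trans (max_le le_rfl hQ)

theorem eval_reflect {k : ℕ} {Q : ℂ[X]} (hQ : Q.natDegree ≤ k) (z : ℂ) :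
    (reflect k Q).eval z = ∑ j ∈ range (k + 1), Q.coeff j * z ^ (k - j) := by
  have hd : (reflect k Q).natDegree < k + 1 := Nat.lt_succ_of_le (natDegree_reflect_le_of_le hQ)
  rw [Polynomial.eval_eq_sum_range' hd, ← Finset.sum_range_reflect]
  refine sum_congr rfl fun j hj => ?_
  have hj' : j ≤ k := Nat.lt_succ_iff.mp (mem_range.mp hj)
  rw [coeff_reflect, show k + 1 - 1 - j = k - j by omega, Polynomial.revAt_le (Nat.sub_le k j),
    Nat.sub_sub_self hj']

theorem eval_reflect_of_ne_zero {k : ℕ} {Q : ℂ[X]} (hQ : Q.natDegree ≤ k) {z : ℂ} (hz : z ≠ 0) :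
    (reflect k Q).eval z = z ^ k * Q.eval z⁻¹ := by
  rw [eval_reflect hQ, Polynomial.eval_eq_sum_range' (Nat.lt_succ_of_le hQ), Finset.mul_sum]
  refine sum_congr rfl fun j hj => ?_
  have hj' : j ≤ k := Nat.lt_succ_iff.mp (mem_range.mp hj)
  rw [pow_sub₀ z hz hj', inv_pow]
  ring

/-- The coefficients beyond degree `k` of `(1 - z) ^ (-a) * z ^ k * Q (1 / z)` are the pairings of `Q`
with the powers of `X`. -/
theorem hasSum_momentFunctional (a : ℂ) {k : ℕ} {Q : ℂ[X]} (hQ : Q.natDegree ≤ k) {z : ℂ}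
    (hz : ‖z‖ < 1) :
    HasSum (fun n => momentFunctional a (Q * X ^ n) * z ^ (n + k))
      ((1 - z) ^ (-a) * (reflect k Q).eval z - (padeNumerator a k Q).eval z) := by
  have h1 : ∀ j ∈ range (k + 1), HasSum
      (fun n => Q.coeff j * jacobiMoment a (n + j) * z ^ (n + k))
      (Q.coeff j * z ^ (k - j) * ((1 - z) ^ (-a) - ∑ n ∈ range j, jacobiMoment a n * z ^ n)) := by
    intro j hj
    have hj' : j ≤ k := Nat.lt_succ_iff.mp (mem_range.mp hj)
    have h := ((hasSum_nat_add_iff' j).mpr (hasSum_jacobiMoment a hz)).mul_left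
      (Q.coeff j * z ^ (k - j))
    have e : (fun n => Q.coeff j * jacobiMoment a (n + j) * z ^ (n + k)) = fun n =>
        Q.coeff j * z ^ (k - j) * (jacobiMoment a (n + j) * z ^ (n + j)) := by
      funext n
      rw [show n + k = k - j + (n + j) by omega, pow_add]
      ring
    rw [e]
    exact h
  have h2 := hasSum_sum h1
  convert h2 using 1
  · funext n
    rw [momentFunctional_mul_X_pow a hQ, Finset.sum_mul]
  · rw [eval_reflect hQ, padeNumerator, Polynomial.eval_finsetSum, Finset.mul_sum,
      ← Finset.sum_sub_distrib]
    refine sum_congr rfl fun j _ => ?_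
    rw [Polynomial.eval_finsetSum, mul_sub, Finset.mul_sum]
    congr 1
    · ring
    · refine sum_congr rfl fun n _ => ?_
      simp only [eval_mul, eval_C, eval_pow, eval_X, pow_add]
      ring

/-- The order of vanishing of the sum of a power series is read off from its coefficients. -/
theorem isBigO_pow_iff_of_hasSum {c : ℕ → ℂ} {g : ℂ → ℂ}
    (h : ∀ z : ℂ, ‖z‖ < 1 → HasSum (fun n => c n * z ^ n) (g z)) (N : ℕ) :
    g =O[𝓝 0] (fun z => z ^ N) ↔ ∀ n < N, c n = 0 := by
  set p := FormalMultilinearSeries.ofScalars ℂ c with hp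
  have hg : HasFPowerSeriesAt g p 0 := by
    rw [hasFPowerSeriesAt_iff]
    filter_upwards [Metric.ball_mem_nhds (0 : ℂ) one_pos] with z hz
    simpa [hp, FormalMultilinearSeries.coeff_ofScalars, mul_comm] using h z (by simpa using hz)
  have hN : ∀ n, (fun y : ℂ => g y - ∑ i ∈ range n, c i * y ^ i) =O[𝓝 0] fun y => y ^ n := by
    intro n
    have h1 := hg.isBigO_sub_partialSum_pow n
    simp only [zero_add, FormalMultilinearSeries.partialSum, hp,
      FormalMultilinearSeries.ofScalars_apply_eq, smul_eq_mul] at h1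
    refine h1.trans (IsBigO.of_norm_right ?_)
    simp only [norm_pow]
    exact isBigO_refl _ _
  constructor
  · intro hO n
    induction n using Nat.strong_induction_on with
    | _ n ih =>
      intro hn
      have h1 := hN (n + 1)
      rw [show (fun y : ℂ => g y - ∑ i ∈ range (n + 1), c i * y ^ i) =
          fun y : ℂ => g y - c n * y ^ n by
        funext y
        rw [Finset.sum_range_succ, Finset.sum_eq_zero, zero_add]
        intro i hi
        rw [mem_range] at hi
        rw [ih i hi (hi.trans hn), zero_mul]] at h1
      have h2 : g =O[𝓝 0] (fun z : ℂ => z ^ (n + 1)) := by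
        obtain ⟨d, rfl⟩ := Nat.exists_eq_add_of_le (show n + 1 ≤ N from hn)
        refine hO.trans ?_
        have h6 : (fun z : ℂ => z ^ d) =O[𝓝 0] fun _ => (1 : ℂ) :=
          ((continuous_pow d).tendsto 0).isBigO_one ℂ
        simpa [pow_add] using (isBigO_refl (fun z : ℂ => z ^ (n + 1)) (𝓝 0)).mul h6
      have h3 : (fun y : ℂ => p n fun _ => y) =O[𝓝 0] fun y : ℂ => ‖y‖ ^ (n + 1) := by
        have h4 := (h2.sub h1).norm_right
        simpa [hp, FormalMultilinearSeries.ofScalars_apply_eq, mul_comm] using h4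
      have h5 := h3.continuousMultilinearMap_apply_eq_zero (1 : ℂ)
      simpa [hp, FormalMultilinearSeries.ofScalars_apply_eq] using h5
  · intro hc
    refine (hN N).congr_left fun y => ?_
    rw [Finset.sum_eq_zero fun i hi => by rw [hc i (mem_range.mp hi), zero_mul], sub_zero]

theorem hasSum_coeff_mul_pow (P : ℂ[X]) (z : ℂ) :
    HasSum (fun n => P.coeff n * z ^ n) (P.eval z) := by
  rw [Polynomial.eval_eq_sum_range]
  refine hasSum_sum_of_ne_finset_zero fun n hn => ?_
  rw [Polynomial.coeff_eq_zero_of_natDegree_lt (by simpa [Nat.succ_le_iff] using hn), zero_mul]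

theorem natDegree_comp_one_sub_X_le (p : ℂ[X]) : (p.comp (1 - X)).natDegree ≤ p.natDegree := by
  have h : (1 - X : ℂ[X]).natDegree ≤ 1 := by compute_degree
  calc _ ≤ p.natDegree * (1 - X : ℂ[X]).natDegree := Polynomial.natDegree_comp_le
    _ ≤ p.natDegree * 1 := Nat.mul_le_mul_left _ h
    _ = _ := mul_one _

/-- In the variable `z = 1 - w`, the reversed denominator of a Padé pair is orthogonal to all
polynomials of degree less than `k`, and it determines the numerator. -/
theorem IsPadePair.orthogonal {a : ℂ} {k : ℕ} (hk : 1 ≤ k) {p q : ℂ[X]}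
    (h : IsPadePair (fun w : ℂ => w ^ (-a)) 1 (k - 1) k p q) :
    p.comp (1 - X) = padeNumerator a k (reflect k (q.comp (1 - X))) ∧
      ∀ i < k, momentFunctional a (reflect k (q.comp (1 - X)) * X ^ i) = 0 := by
  set p' := p.comp (1 - X) with hp'
  set q' := q.comp (1 - X) with hq'
  set Q := reflect k q' with hQ
  have hpd : p'.natDegree ≤ k - 1 := (natDegree_comp_one_sub_X_le p).trans h.natDegree_num_le
  have hqd : q'.natDegree ≤ k := (natDegree_comp_one_sub_X_le q).trans h.natDegree_den_le
  have hQd : Q.natDegree ≤ k := natDegree_reflect_le_of_le hqd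
  have hQQ : reflect k Q = q' := by
    ext n
    rw [hQ, coeff_reflect, coeff_reflect, Polynomial.revAt_invol]
  have hp0 : ∀ z, p'.eval z = p.eval (1 - z) := fun z => by simp [hp']
  have hq0 : ∀ z, q'.eval z = q.eval (1 - z) := fun z => by simp [hq']
  have ht : Filter.Tendsto (fun z : ℂ => 1 - z) (𝓝 0) (𝓝 1) :=
    Continuous.tendsto' (by fun_prop) _ _ (by simp)
  have hO : (fun z : ℂ => (1 - z) ^ (-a) * q'.eval z - p'.eval z) =O[𝓝 0]
      fun z => z ^ (2 * k) := by
    have h1 := h.isBigO.comp_tendsto ht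
    have h2 : (fun z : ℂ => q'.eval z) =O[𝓝 0] fun _ => (1 : ℂ) :=
      (q'.continuous.tendsto 0).isBigO_one ℂ
    have h3 := (h1.mul h2).norm_right
    refine (h3.congr' ?_ ?_).of_norm_right
    · have h4 : ∀ᶠ z in 𝓝 (0 : ℂ), q'.eval z ≠ 0 :=
        q'.continuous.continuousAt.eventually_ne (by rw [hq0]; simpa using h.den_ne_zero)
      filter_upwards [h4] with z hz
      simp only [Function.comp_apply]
      rw [← hp0, ← hq0, sub_mul, div_mul_cancel₀ _ hz]
    · refine Filter.Eventually.of_forall fun z => ?_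
      simp only [Function.comp_apply, mul_one, norm_pow]
      rw [show k - 1 + k + 1 = 2 * k by omega, sub_sub_cancel_left, norm_neg]
  -- the Taylor coefficients of `(1 - z) ^ (-a) * q' - p'`; the two summands have disjoint supports
  set c : ℕ → ℂ := fun n => (padeNumerator a k Q - p').coeff n +
    if k ≤ n then momentFunctional a (Q * X ^ (n - k)) else 0 with hc
  have hsum : ∀ z : ℂ, ‖z‖ < 1 → HasSum (fun n => c n * z ^ n)
      ((1 - z) ^ (-a) * q'.eval z - p'.eval z) := by
    intro z hz
    have h1 := hasSum_momentFunctional a hQd hz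
    have h2 : HasSum (fun n => (if k ≤ n then momentFunctional a (Q * X ^ (n - k)) else 0) * z ^ n)
        ((1 - z) ^ (-a) * (reflect k Q).eval z - (padeNumerator a k Q).eval z) := by
      rw [← hasSum_nat_add_iff' k, Finset.sum_eq_zero, sub_zero]
      · simpa using h1
      · intro i hi
        rw [if_neg (by simpa using hi), zero_mul]
    have h3 := (hasSum_coeff_mul_pow (padeNumerator a k Q - p') z).add h2
    convert h3 using 1
    · funext n
      rw [hc, add_mul]
    · rw [hQQ, eval_sub]; ring
  have hzero := (isBigO_pow_iff_of_hasSum hsum (2 * k)).mp hO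
  have hdeg : (padeNumerator a k Q - p').natDegree < k := by
    have := Polynomial.natDegree_sub_le_of_le (natDegree_padeNumerator_le a k Q) hpd
    rw [max_self] at this
    omega
  constructor
  · rw [eq_comm, ← sub_eq_zero]
    ext n
    rw [coeff_zero]
    by_cases hn : n < k
    · simpa [hc, hn.not_ge] using hzero n (by omega)
    · exact Polynomial.coeff_eq_zero_of_natDegree_lt (by omega)
  · intro i hi
    have h1 := hzero (i + k) (by omega)
    rw [hc] at h1
    simpa [Polynomial.coeff_eq_zero_of_natDegree_lt
      (show (padeNumerator a k Q - p').natDegree < i + k by omega)] using h1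

theorem isPadePair_of_orthogonal {a : ℂ} {k : ℕ} (hk : 1 ≤ k) {Q : ℂ[X]} (hQ : Q.natDegree ≤ k)
    (hQk : Q.coeff k ≠ 0) (h : ∀ i < k, momentFunctional a (Q * X ^ i) = 0) :
    IsPadePair (fun w : ℂ => w ^ (-a)) 1 (k - 1) k ((padeNumerator a k Q).comp (1 - X))
      ((reflect k Q).comp (1 - X)) := by
  have hq0 : (reflect k Q).eval 0 ≠ 0 := by
    rwa [← coeff_zero_eq_eval_zero, coeff_reflect, Polynomial.revAt_le (Nat.zero_le k), Nat.sub_zero]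
  have hsum : ∀ z : ℂ, ‖z‖ < 1 → HasSum
      (fun n => (if k ≤ n then momentFunctional a (Q * X ^ (n - k)) else 0) * z ^ n)
      ((1 - z) ^ (-a) * (reflect k Q).eval z - (padeNumerator a k Q).eval z) := by
    intro z hz
    rw [← hasSum_nat_add_iff' k, Finset.sum_eq_zero, sub_zero]
    · simpa using hasSum_momentFunctional a hQ hz
    · intro i hi
      rw [if_neg (by simpa using hi), zero_mul]
  have hO := (isBigO_pow_iff_of_hasSum hsum (2 * k)).mpr fun n hn => by
    split_ifs with hkn
    · exact h _ (by omega)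
    · rfl
  refine ⟨(natDegree_comp_one_sub_X_le _).trans (natDegree_padeNumerator_le a k Q),
    (natDegree_comp_one_sub_X_le _).trans (natDegree_reflect_le_of_le hQ), by simpa using hq0, ?_⟩
  · have ht : Filter.Tendsto (fun w : ℂ => 1 - w) (𝓝 1) (𝓝 0) :=
      Continuous.tendsto' (by fun_prop) _ _ (by simp)
    have hcont : ContinuousAt (fun z : ℂ => ((reflect k Q).eval z)⁻¹) 0 :=
      (reflect k Q).continuous.continuousAt.inv₀ hq0
    have h1 := ((hO.mul (hcont.tendsto.isBigO_one ℂ)).comp_tendsto ht).norm_right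
    refine (h1.congr' ?_ ?_).of_norm_right
    · have h4 : ∀ᶠ w in 𝓝 (1 : ℂ), (reflect k Q).eval (1 - w) ≠ 0 :=
        ht.eventually ((reflect k Q).continuous.continuousAt.eventually_ne hq0)
      filter_upwards [h4] with w hw
      simp only [Function.comp_apply, eval_comp, eval_sub, eval_one, eval_X, sub_sub_cancel]
      field_simp
    · refine Filter.Eventually.of_forall fun w => ?_
      simp only [Function.comp_apply, mul_one, norm_pow]
      rw [show k - 1 + k + 1 = 2 * k by omega, norm_sub_rev]

/-- A quadrature rule at zeros of `Q` which reproduces the first `k` moments turns the Cauchy kernel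
`1 / (1 - z s)` into `padeNumerator a k Q / reflect k Q`. -/
theorem eval_padeNumerator_of_quadrature {a : ℂ} {k : ℕ} {Q : ℂ[X]} (hQ : Q.natDegree ≤ k)
    {ι : Type*} [Fintype ι] {s w : ι → ℂ} (hs : ∀ i, Q.eval (s i) = 0)
    (hw : ∀ n < k, ∑ i, w i * s i ^ n = jacobiMoment a n) {z : ℂ} (hz : ∀ i, 1 - z * s i ≠ 0) :
    (padeNumerator a k Q).eval z = (reflect k Q).eval z * ∑ i, w i * (1 - z * s i)⁻¹ := by
  have h1 : ∀ i, ∑ j ∈ range (k + 1), Q.coeff j * z ^ (k - j) * ∑ n ∈ range j, (z * s i) ^ n =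
      (reflect k Q).eval z * (1 - z * s i)⁻¹ := by
    intro i
    rw [eq_mul_inv_iff_mul_eq₀ (hz i), Finset.sum_mul, eval_reflect hQ,
      ← sub_zero (∑ j ∈ range (k + 1), Q.coeff j * z ^ (k - j)), ← mul_zero (z ^ k), ← hs i,
      Polynomial.eval_eq_sum_range' (Nat.lt_succ_of_le hQ), Finset.mul_sum,
      ← Finset.sum_sub_distrib]
    refine sum_congr rfl fun j hj => ?_
    have hj' : j ≤ k := Nat.lt_succ_iff.mp (mem_range.mp hj)
    rw [mul_assoc, geom_sum_mul_neg, mul_pow, show z ^ k = z ^ (k - j) * z ^ j by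
      rw [← pow_add, Nat.sub_add_cancel hj']]
    ring
  calc _ = ∑ j ∈ range (k + 1), ∑ n ∈ range j, ∑ i,
        w i * (Q.coeff j * z ^ (k - j) * (z * s i) ^ n) := by
        rw [padeNumerator, Polynomial.eval_finsetSum]
        refine sum_congr rfl fun j hj => ?_
        rw [Polynomial.eval_finsetSum]
        refine sum_congr rfl fun n hn => ?_
        rw [mem_range] at hj hn
        rw [← hw n (by omega), eval_mul, eval_C, eval_pow, eval_X, Finset.mul_sum, Finset.sum_mul]
        refine sum_congr rfl fun i _ => ?_
        rw [pow_add, mul_pow]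
        ring
    _ = ∑ i, w i * ∑ j ∈ range (k + 1), Q.coeff j * z ^ (k - j) *
          ∑ n ∈ range j, (z * s i) ^ n := by
        simp only [Finset.mul_sum]
        rw [Finset.sum_comm]
        conv_lhs => enter [2, j]; rw [Finset.sum_comm]
    _ = _ := by
        rw [Finset.mul_sum]
        refine sum_congr rfl fun i _ => ?_
        rw [h1 i]
        ring

/-! ### The beta weight -/

/-- The weight `s ^ (α - 1) * (1 - s) ^ (-α)` on `(0, 1)`, which is `jacobiWeight α` in the variable
`s = (1 + t) / 2`. -/
noncomputable def betaWeight (α s : ℝ) : ℝ := s ^ (α - 1) * (1 - s) ^ (-α)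

theorem betaWeight_pos (α : ℝ) {s : ℝ} (hs : s ∈ Set.Ioo (0 : ℝ) 1) : 0 < betaWeight α s :=
  mul_pos (Real.rpow_pos_of_pos hs.1 _) (Real.rpow_pos_of_pos (sub_pos.mpr hs.2) _)

theorem ofReal_betaWeight (α : ℝ) {s : ℝ} (hs : s ∈ Set.Icc (0 : ℝ) 1) :
    (betaWeight α s : ℂ) = (s : ℂ) ^ ((α : ℂ) - 1) * (1 - (s : ℂ)) ^ ((1 - (α : ℂ)) - 1) := by
  rw [betaWeight, Complex.ofReal_mul, Complex.ofReal_cpow hs.1,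
    Complex.ofReal_cpow (sub_nonneg.mpr hs.2)]
  push_cast
  congr 2
  ring

theorem intervalIntegrable_betaWeight_mul {α : ℝ} (hα0 : 0 < α) (hα1 : α < 1) {f : ℝ → ℂ}
    (hf : Continuous f) :
    IntervalIntegrable (fun s => (betaWeight α s : ℂ) * f s) volume 0 1 := by
  have h := Complex.betaIntegral_convergent (u := α) (v := 1 - α) (by simpa using hα0)
    (by simpa using hα1)
  have h1 : IntervalIntegrable (fun s => (betaWeight α s : ℂ)) volume 0 1 := by
    refine h.congr fun s hs => ?_
    rw [Set.uIoc_of_le zero_le_one] at hs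
    exact (ofReal_betaWeight α ⟨hs.1.le, hs.2⟩).symm
  exact h1.mul_continuousOn hf.continuousOn

theorem Gamma_add_nat {a : ℂ} (ha : ∀ n : ℕ, a + n ≠ 0) (n : ℕ) :
    Complex.Gamma (a + n) = (ascPochhammer ℂ n).eval a * Complex.Gamma a := by
  induction n with
  | zero => simp
  | succ n ih =>
    rw [Nat.cast_succ, ← add_assoc, Complex.Gamma_add_one _ (ha n), ih, ascPochhammer_succ_eval]
    ring

theorem ofReal_add_nat_ne_zero {α : ℝ} (hα0 : 0 < α) (n : ℕ) : (α : ℂ) + n ≠ 0 := by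
  have : α + n ≠ 0 := by positivity
  exact_mod_cast this

theorem integral_betaWeight_mul_pow {α : ℝ} (hα0 : 0 < α) (hα1 : α < 1) (n : ℕ) :
    ∫ s in (0 : ℝ)..1, (betaWeight α s : ℂ) * (s : ℂ) ^ n =
      ((Real.pi / Real.sin (α * Real.pi) : ℝ) : ℂ) * jacobiMoment α n := by
  have h1 : ∫ s in (0 : ℝ)..1, (betaWeight α s : ℂ) * (s : ℂ) ^ n =
      Complex.betaIntegral (α + n) (1 - α) := by
    rw [Complex.betaIntegral, intervalIntegral.integral_of_le zero_le_one,
      intervalIntegral.integral_of_le zero_le_one]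
    refine setIntegral_congr_fun measurableSet_Ioc fun s hs => ?_
    have hs0 : (s : ℂ) ≠ 0 := by exact_mod_cast hs.1.ne'
    rw [ofReal_betaWeight α ⟨hs.1.le, hs.2⟩, show (α : ℂ) + n - 1 = (α - 1) + n by ring,
      Complex.cpow_add _ _ hs0, Complex.cpow_natCast]
    ring
  have hre : (0 : ℝ) < ((α : ℂ) + n).re := by simp; positivity
  have hre' : (0 : ℝ) < (1 - (α : ℂ)).re := by simpa using hα1
  rw [h1, Complex.betaIntegral_eq_Gamma_mul_div _ _ hre hre',
    Gamma_add_nat (ofReal_add_nat_ne_zero hα0), show (α : ℂ) + n + (1 - α) = n + 1 by ring,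
    Complex.Gamma_nat_eq_factorial, jacobiMoment]
  have h2 := Complex.Gamma_mul_Gamma_one_sub (α : ℂ)
  push_cast
  rw [mul_comm (α : ℂ) (Real.pi : ℂ), ← h2]
  ring

theorem sin_mul_pi_pos {α : ℝ} (hα0 : 0 < α) (hα1 : α < 1) : 0 < Real.sin (α * Real.pi) :=
  Real.sin_pos_of_pos_of_lt_pi (by positivity)
    (by nlinarith [Real.pi_pos])

/-- The moment functional is integration against the beta weight, with total mass
`π / sin (α π)`. -/
theorem integral_betaWeight_mul_eval {α : ℝ} (hα0 : 0 < α) (hα1 : α < 1) (Q : ℂ[X]) :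
    ∫ s in (0 : ℝ)..1, (betaWeight α s : ℂ) * Q.eval (s : ℂ) =
      ((Real.pi / Real.sin (α * Real.pi) : ℝ) : ℂ) * momentFunctional α Q := by
  have hc : ∀ P : ℂ[X], Continuous fun s : ℝ => P.eval (s : ℂ) := fun P =>
    P.continuous.comp Complex.continuous_ofReal
  induction Q using Polynomial.induction_on' with
  | add p q hp hq =>
    simp only [eval_add, mul_add, map_add]
    rw [intervalIntegral.integral_add (intervalIntegrable_betaWeight_mul hα0 hα1 (hc p))
      (intervalIntegrable_betaWeight_mul hα0 hα1 (hc q)), hp, hq]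
  | monomial n c =>
    rw [← C_mul_X_pow_eq_monomial, ← Polynomial.smul_eq_C_mul, map_smul, momentFunctional_X_pow,
      smul_eq_mul, mul_left_comm, ← integral_betaWeight_mul_pow hα0 hα1 n,
      ← intervalIntegral.integral_const_mul]
    congr 1
    funext s
    simp only [eval_smul, eval_pow, eval_X, smul_eq_mul]
    ring

theorem integral_betaWeight_mul_pos {α : ℝ} (hα0 : 0 < α) (hα1 : α < 1) {g : ℝ → ℝ}
    (hg : Continuous g) (hg0 : ∀ s ∈ Set.Ioo (0 : ℝ) 1, 0 ≤ g s)
    (hg1 : ∃ s ∈ Set.Ioo (0 : ℝ) 1, 0 < g s) :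
    0 < ∫ s in (0 : ℝ)..1, betaWeight α s * g s := by
  have hint : IntervalIntegrable (fun s => betaWeight α s * g s) volume 0 1 := by
    have h := intervalIntegrable_betaWeight_mul hα0 hα1 (f := fun s => (g s : ℂ))
      (Complex.continuous_ofReal.comp hg)
    have h2 : IntervalIntegrable (fun s => ((betaWeight α s : ℂ) * (g s : ℂ)).re) volume 0 1 :=
      ⟨h.1.re, h.2.re⟩
    simpa [← Complex.ofReal_mul] using h2
  have hae : 0 ≤ᵐ[volume.restrict (Set.Ioc (0 : ℝ) 1)] fun s => betaWeight α s * g s := by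
    rw [← restrict_Ioo_eq_restrict_Ioc, Filter.EventuallyLE,
      ae_restrict_iff' measurableSet_Ioo]
    exact Filter.Eventually.of_forall fun s hs => mul_nonneg (betaWeight_pos α hs).le (hg0 s hs)
  rw [intervalIntegral.integral_pos_iff_support_of_nonneg_ae'
    (by rwa [Set.uIoc_of_le zero_le_one]) hint]
  refine ⟨one_pos, ?_⟩
  obtain ⟨s, hs, hgs⟩ := hg1
  have hopen : IsOpen (Set.Ioo (0 : ℝ) 1 ∩ {s | 0 < g s}) :=
    isOpen_Ioo.inter (isOpen_lt continuous_const hg)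
  refine (hopen.measure_pos volume ⟨s, hs, hgs⟩).trans_le (measure_mono ?_)
  rintro t ⟨ht, hgt⟩
  exact ⟨(mul_pos (betaWeight_pos α ht) hgt).ne', Set.Ioo_subset_Ioc_self ht⟩

/-! ### Zeros of orthogonal polynomials -/

theorem exists_mem_Ioo_eval_ne_zero {R : ℂ[X]} (hR : R ≠ 0) :
    ∃ s ∈ Set.Ioo (0 : ℝ) 1, R.eval (s : ℂ) ≠ 0 := by
  by_contra! h
  refine hR (Polynomial.eq_zero_of_infinite_isRoot R ?_)
  refine ((Set.Ioo_infinite (zero_lt_one' ℝ)).image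
    Complex.ofReal_injective.injOn).mono ?_
  rintro _ ⟨s, hs, rfl⟩
  exact h s hs

/-- Pairing with the conjugate: for a real factor `g`, the functional at `g * R * conj R` is a
weighted integral of `|R|²`. -/
theorem momentFunctional_mul_conj {α : ℝ} (hα0 : 0 < α) (hα1 : α < 1) (g : ℝ[X]) (R : ℂ[X]) :
    momentFunctional α (g.map Complex.ofRealHom * R * R.map (starRingEnd ℂ)) =
      ((Real.sin (α * Real.pi) / Real.pi *
        ∫ s in (0 : ℝ)..1, betaWeight α s * (g.eval s * ‖R.eval (s : ℂ)‖ ^ 2) : ℝ) : ℂ) := by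
  have h := integral_betaWeight_mul_eval hα0 hα1
    (g.map Complex.ofRealHom * R * R.map (starRingEnd ℂ))
  have h1 : ∫ s in (0 : ℝ)..1, (betaWeight α s : ℂ) *
        (g.map Complex.ofRealHom * R * R.map (starRingEnd ℂ)).eval (s : ℂ) =
      ∫ s in (0 : ℝ)..1, ((betaWeight α s * (g.eval s * ‖R.eval (s : ℂ)‖ ^ 2) : ℝ) : ℂ) := by
    congr 1
    funext s
    have e1 : (R.map (starRingEnd ℂ)).eval (s : ℂ) = (starRingEnd ℂ) (R.eval (s : ℂ)) := by
      conv_lhs => rw [← Complex.conj_ofReal s, eval_map, eval₂_at_apply]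
    have e2 : (g.map Complex.ofRealHom).eval (s : ℂ) = ((g.eval s : ℝ) : ℂ) := by
      rw [← Complex.ofRealHom_eq_coe s, eval_map, eval₂_at_apply, Complex.ofRealHom_eq_coe]
    rw [eval_mul, eval_mul, e1, e2, mul_assoc ((g.eval s : ℝ) : ℂ), Complex.mul_conj']
    push_cast
    ring
  rw [h1, intervalIntegral.integral_ofReal] at h
  have hs : (Real.sin (α * Real.pi) : ℂ) ≠ 0 := by exact_mod_cast (sin_mul_pi_pos hα0 hα1).ne'
  have hp : (Real.pi : ℂ) ≠ 0 := by exact_mod_cast Real.pi_ne_zero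
  rw [Complex.ofReal_mul, h]
  push_cast at hs ⊢
  field_simp

theorem integral_betaWeight_mul_normSq_pos {α : ℝ} (hα0 : 0 < α) (hα1 : α < 1) {g : ℝ[X]}
    (hg0 : ∀ s ∈ Set.Ioo (0 : ℝ) 1, 0 ≤ g.eval s) (hg : g ≠ 0) {R : ℂ[X]} (hR : R ≠ 0) :
    0 < ∫ s in (0 : ℝ)..1, betaWeight α s * (g.eval s * ‖R.eval (s : ℂ)‖ ^ 2) := by
  refine integral_betaWeight_mul_pos hα0 hα1 (g.continuous.mul
    ((R.continuous.comp Complex.continuous_ofReal).norm.pow 2))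
    (fun s hs => mul_nonneg (hg0 s hs) (by positivity)) ?_
  have hgR : g.map Complex.ofRealHom * R ≠ 0 :=
    mul_ne_zero ((Polynomial.map_ne_zero_iff Complex.ofReal_injective).mpr hg) hR
  obtain ⟨s, hs, h⟩ := exists_mem_Ioo_eval_ne_zero hgR
  rw [eval_mul, ← Complex.ofRealHom_eq_coe s, eval_map, eval₂_at_apply] at h
  obtain ⟨h1, h2⟩ := mul_ne_zero_iff.mp h
  have h1' : g.eval s ≠ 0 := by simpa using h1
  exact ⟨s, hs, mul_pos ((hg0 s hs).lt_of_ne' h1') (pow_pos (norm_pos_iff.mpr h2) 2)⟩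

theorem momentFunctional_mul_conj_ne_zero {α : ℝ} (hα0 : 0 < α) (hα1 : α < 1) {g : ℝ[X]}
    (hg0 : ∀ s ∈ Set.Ioo (0 : ℝ) 1, 0 ≤ g.eval s) (hg : g ≠ 0) {R : ℂ[X]} (hR : R ≠ 0) :
    momentFunctional α (g.map Complex.ofRealHom * R * R.map (starRingEnd ℂ)) ≠ 0 := by
  rw [momentFunctional_mul_conj hα0 hα1, Complex.ofReal_ne_zero]
  exact (mul_pos (div_pos (sin_mul_pi_pos hα0 hα1) Real.pi_pos)
    (integral_betaWeight_mul_normSq_pos hα0 hα1 hg0 hg hR)).ne'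

theorem momentFunctional_mul_eq_zero {a : ℂ} {k : ℕ} {Q R : ℂ[X]}
    (h : ∀ i < k, momentFunctional a (Q * X ^ i) = 0) (hR : R.natDegree < k) :
    momentFunctional a (Q * R) = 0 := by
  rw [R.as_sum_range_C_mul_X_pow' hR, Finset.mul_sum, map_sum]
  refine Finset.sum_eq_zero fun i hi => ?_
  rw [mul_left_comm, ← Polynomial.smul_eq_C_mul, map_smul, h i (mem_range.mp hi), smul_zero]

theorem coeff_ne_zero_of_orthogonal {α : ℝ} (hα0 : 0 < α) (hα1 : α < 1) {k : ℕ}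
    {Q : ℂ[X]} (hQ : Q.natDegree ≤ k) (hQ0 : Q ≠ 0)
    (h : ∀ i < k, momentFunctional α (Q * X ^ i) = 0) : Q.coeff k ≠ 0 := by
  intro hc
  have hlt : Q.natDegree < k := by
    rcases hQ.lt_or_eq with h1 | h1
    · exact h1
    · rw [← h1, coeff_natDegree, leadingCoeff_eq_zero] at hc
      exact absurd hc hQ0
  refine momentFunctional_mul_conj_ne_zero hα0 hα1 (g := 1) (by simp) one_ne_zero hQ0 ?_
  rw [Polynomial.map_one, one_mul]
  exact momentFunctional_mul_eq_zero h ((natDegree_map_le).trans_lt hlt)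

/-- The orthogonal polynomial of degree `k` is unique up to a factor. -/
theorem eq_C_mul_of_orthogonal {α : ℝ} (hα0 : 0 < α) (hα1 : α < 1) {k : ℕ}
    {P Q : ℂ[X]} (hP : P.natDegree ≤ k) (hPk : P.coeff k ≠ 0)
    (hPo : ∀ i < k, momentFunctional α (P * X ^ i) = 0) (hQ : Q.natDegree ≤ k)
    (hQo : ∀ i < k, momentFunctional α (Q * X ^ i) = 0) :
    Q = C (Q.coeff k / P.coeff k) * P := by
  rw [← sub_eq_zero]
  by_contra hne
  refine coeff_ne_zero_of_orthogonal (k := k) hα0 hα1 ?_ hne (fun i hi => ?_) ?_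
  · simpa using Polynomial.natDegree_sub_le_of_le hQ ((natDegree_C_mul_le _ _).trans hP)
  · rw [sub_mul, map_sub, hQo i hi, mul_assoc, ← Polynomial.smul_eq_C_mul, map_smul, hPo i hi,
      smul_zero, sub_zero]
  · rw [coeff_sub, coeff_C_mul, div_mul_cancel₀ _ hPk, sub_self]

/-- A zero `x` of `Q = (X - x) R` is the mean of `s` for the positive weight `|R s|²`. -/
theorem exists_mem_Ioo_of_eval_eq_zero {α : ℝ} (hα0 : 0 < α) (hα1 : α < 1) {k : ℕ} {Q : ℂ[X]}
    (hQ : Q.natDegree ≤ k) (hQ0 : Q ≠ 0) (h : ∀ i < k, momentFunctional α (Q * X ^ i) = 0) {x : ℂ}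
    (hx : Q.eval x = 0) : ∃ r ∈ Set.Ioo (0 : ℝ) 1, x = r := by
  obtain ⟨R, hR⟩ := dvd_iff_isRoot.mpr hx
  have hR0 : R ≠ 0 := by rintro rfl; exact hQ0 (by rw [hR, mul_zero])
  have hdeg : R.natDegree < k := by
    have : Q.natDegree = 1 + R.natDegree := by
      rw [hR, natDegree_mul (X_sub_C_ne_zero x) hR0, natDegree_X_sub_C]
    omega
  have h0 := momentFunctional_mul_eq_zero h
    (R := R.map (starRingEnd ℂ)) (natDegree_map_le.trans_lt hdeg)
  have h1 : Q * R.map (starRingEnd ℂ) =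
      (X : ℝ[X]).map Complex.ofRealHom * R * R.map (starRingEnd ℂ) -
        x • ((1 : ℝ[X]).map Complex.ofRealHom * R * R.map (starRingEnd ℂ)) := by
    rw [hR, Polynomial.smul_eq_C_mul, Polynomial.map_X, Polynomial.map_one]
    ring
  rw [h1, map_sub, map_smul, momentFunctional_mul_conj hα0 hα1, momentFunctional_mul_conj hα0 hα1,
    smul_eq_mul] at h0
  set c := Real.sin (α * Real.pi) / Real.pi with hc
  have hc0 : 0 < c := div_pos (sin_mul_pi_pos hα0 hα1) Real.pi_pos
  set A := ∫ s in (0 : ℝ)..1, betaWeight α s * ((X : ℝ[X]).eval s * ‖R.eval (s : ℂ)‖ ^ 2) with hA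
  set B := ∫ s in (0 : ℝ)..1, betaWeight α s * ((1 : ℝ[X]).eval s * ‖R.eval (s : ℂ)‖ ^ 2) with hB
  have hApos : 0 < A := integral_betaWeight_mul_normSq_pos hα0 hα1 (g := X)
    (fun s hs => by simpa using hs.1.le) X_ne_zero hR0
  have hBpos : 0 < B := integral_betaWeight_mul_normSq_pos hα0 hα1 (g := 1)
    (fun s hs => by simp) one_ne_zero hR0
  have hxr : x = ((A / B : ℝ) : ℂ) := by
    have hB' : (B : ℂ) ≠ 0 := by exact_mod_cast hBpos.ne'
    have hc' : (c : ℂ) ≠ 0 := by exact_mod_cast hc0.ne'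
    push_cast at h0 ⊢
    rw [eq_div_iff hB']
    apply mul_left_cancel₀ hc'
    linear_combination -h0
  have hBA : 0 < B - A := by
    have h2 := integral_betaWeight_mul_normSq_pos hα0 hα1 (g := 1 - X)
      (fun s hs => by simpa using hs.2.le)
      (fun h => by simpa using congrArg (Polynomial.eval 0) h) hR0
    have hi : ∀ g : ℝ[X], IntervalIntegrable
        (fun s => betaWeight α s * (g.eval s * ‖R.eval (s : ℂ)‖ ^ 2)) volume 0 1 := by
      intro g
      have h3 := intervalIntegrable_betaWeight_mul hα0 hα1
        (f := fun s => ((g.eval s * ‖R.eval (s : ℂ)‖ ^ 2 : ℝ) : ℂ))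
        (Complex.continuous_ofReal.comp (g.continuous.mul
          ((R.continuous.comp Complex.continuous_ofReal).norm.pow 2)))
      have h4 : IntervalIntegrable (fun s => ((betaWeight α s : ℂ) *
        ((g.eval s * ‖R.eval (s : ℂ)‖ ^ 2 : ℝ) : ℂ)).re) volume 0 1 := ⟨h3.1.re, h3.2.re⟩
      simpa only [← Complex.ofReal_mul, Complex.ofReal_re] using h4
    rw [hA, hB, ← intervalIntegral.integral_sub (hi 1) (hi X)]
    convert h2 using 3 with s
    simp only [eval_sub, eval_one, eval_X]
    ring
  exact ⟨A / B, ⟨div_pos hApos hBpos, (div_lt_one hBpos).mpr (by linarith)⟩, hxr⟩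

/-- If `r` were a double zero, `Q = (X - r)² R` would pair with the conjugate of `R` to a positive
number. -/
theorem nodup_roots_of_orthogonal {α : ℝ} (hα0 : 0 < α) (hα1 : α < 1) {k : ℕ} {Q : ℂ[X]}
    (hQ : Q.natDegree ≤ k) (hQ0 : Q ≠ 0) (h : ∀ i < k, momentFunctional α (Q * X ^ i) = 0) :
    Q.roots.Nodup := by
  rw [Multiset.nodup_iff_count_le_one]
  intro x
  rw [count_roots]
  by_contra! hlt
  obtain ⟨R, hR⟩ := (le_rootMultiplicity_iff hQ0).mp (show 2 ≤ rootMultiplicity x Q from hlt)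
  have hx : Q.eval x = 0 := by rw [hR]; simp
  obtain ⟨r, hr, rfl⟩ := exists_mem_Ioo_of_eval_eq_zero hα0 hα1 hQ hQ0 h hx
  have hR0 : R ≠ 0 := by rintro rfl; exact hQ0 (by rw [hR, mul_zero])
  have hdeg : R.natDegree < k := by
    have : Q.natDegree = 2 + R.natDegree := by
      rw [hR, natDegree_mul (pow_ne_zero _ (X_sub_C_ne_zero _)) hR0, natDegree_pow,
        natDegree_X_sub_C]
    omega
  have hg : ((X - C r) ^ 2 : ℝ[X]).map Complex.ofRealHom = (X - C (r : ℂ)) ^ 2 := by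
    simp
  refine momentFunctional_mul_conj_ne_zero hα0 hα1 (g := (X - C r) ^ 2)
    (fun s _ => by simpa using sq_nonneg _) (pow_ne_zero _ (X_sub_C_ne_zero r)) hR0 ?_
  rw [hg, ← hR]
  exact momentFunctional_mul_eq_zero h (natDegree_map_le.trans_lt hdeg)

/-! ### The integral representation -/

/-- The substitution `t = 2 s - 1`. -/
theorem integral_jacobiWeight_mul (α : ℝ) (f : ℝ → ℝ) :
    ∫ t in (-1 : ℝ)..1, jacobiWeight α t * f t =
      ∫ s in (0 : ℝ)..1, betaWeight α s * f (2 * s - 1) := by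
  have h := intervalIntegral.integral_comp_mul_sub (a := 0) (b := 1)
    (fun t => jacobiWeight α t * f t) (two_ne_zero' ℝ) 1
  norm_num at h
  have h2 : ∫ t in (-1 : ℝ)..1, jacobiWeight α t * f t =
      2 * ∫ s in (0 : ℝ)..1, jacobiWeight α (2 * s - 1) * f (2 * s - 1) := by
    rw [h]; ring
  rw [h2, ← intervalIntegral.integral_const_mul, intervalIntegral.integral_of_le zero_le_one,
    intervalIntegral.integral_of_le zero_le_one]
  refine setIntegral_congr_fun measurableSet_Ioc fun s hs => ?_
  have e1 : (1 - (2 * s - 1)) = 2 * (1 - s) := by ring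
  have e2 : (1 + (2 * s - 1)) = 2 * s := by ring
  have e3 : (2 : ℝ) * (2 ^ (-α) * 2 ^ (α - 1)) = 1 := by
    rw [← Real.rpow_add two_pos, show -α + (α - 1) = -1 by ring, Real.rpow_neg_one]
    norm_num
  rw [jacobiWeight, betaWeight, e1, e2, Real.mul_rpow two_pos.le (sub_nonneg.mpr hs.2),
    Real.mul_rpow two_pos.le hs.1.le]
  linear_combination (s ^ (α - 1) * (1 - s) ^ (-α) * f (2 * s - 1)) * e3

/-- The Möbius substitution `t = (τ v - l (1 - v)) / (τ v + l (1 - v))`, for which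
`τ (1 - t) / (1 + t) = l (1 - v) / v`, turns the integrand into a beta integrand. -/
theorem integral_jacobiWeight_mul_quadIntegrand {α : ℝ} (hα0 : 0 < α) (hα1 : α < 1) {τ l : ℝ}
    (hτ : 0 < τ) (hl : 0 < l) :
    (l : ℂ) ^ (-(α : ℂ)) = (quadConst α τ : ℂ) *
      ∫ t in (-1 : ℝ)..1, (jacobiWeight α t : ℂ) * quadIntegrand τ (l : ℂ) t := by
  set D : ℝ → ℝ := fun v => τ * v + l * (1 - v) with hD
  set φ : ℝ → ℝ := fun v => (τ * v - l * (1 - v)) / D v with hφ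
  have hDpos : ∀ v ∈ Set.Ioo (0 : ℝ) 1, 0 < D v := fun v hv =>
    add_pos (mul_pos hτ hv.1) (mul_pos hl (sub_pos.mpr hv.2))
  have h1p : ∀ v ∈ Set.Ioo (0 : ℝ) 1, 1 + φ v = 2 * τ * v / D v := fun v hv => by
    have := (hDpos v hv).ne'
    simp only [hφ]
    rw [eq_div_iff this, add_mul, div_mul_cancel₀ _ this]
    simp only [hD]; ring
  have h1m : ∀ v ∈ Set.Ioo (0 : ℝ) 1, 1 - φ v = 2 * l * (1 - v) / D v := fun v hv => by
    have := (hDpos v hv).ne'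
    simp only [hφ]
    rw [eq_div_iff this, sub_mul, div_mul_cancel₀ _ this]
    simp only [hD]; ring
  have hderiv : ∀ v ∈ Set.Ioo (0 : ℝ) 1,
      HasDerivWithinAt φ (2 * τ * l / D v ^ 2) (Set.Ioo 0 1) v := by
    intro v hv
    have hne := (hDpos v hv).ne'
    have d1 : HasDerivAt (fun v : ℝ => τ * v - l * (1 - v)) (τ * 1 - l * (0 - 1)) v :=
      ((hasDerivAt_id v).const_mul τ).sub (((hasDerivAt_const v 1).sub (hasDerivAt_id v)).const_mul l)
    have d2 : HasDerivAt D (τ * 1 + l * (0 - 1)) v :=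
      ((hasDerivAt_id v).const_mul τ).add (((hasDerivAt_const v 1).sub (hasDerivAt_id v)).const_mul l)
    have d3 := (d1.div d2 hne).hasDerivWithinAt (s := Set.Ioo 0 1)
    have e : 2 * τ * l = (τ * 1 - l * (0 - 1)) * D v -
        (τ * v - l * (1 - v)) * (τ * 1 + l * (0 - 1)) := by
      simp only [hD]; ring
    rw [e]
    exact d3
  have hinj : Set.InjOn φ (Set.Ioo 0 1) := by
    intro v hv u hu h
    have e1 := h1p v hv
    rw [h, h1p u hu, div_eq_div_iff (hDpos u hu).ne' (hDpos v hv).ne'] at e1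
    simp only [hD] at e1
    have e2 : (2 * τ * l) * (u - v) = 0 := by linear_combination e1
    have := (mul_eq_zero.mp e2).resolve_left (by positivity)
    linarith
  have himage : φ '' Set.Ioo 0 1 = Set.Ioo (-1) 1 := by
    ext t
    constructor
    · rintro ⟨v, hv, rfl⟩
      have hp : 0 < 2 * τ * v / D v := div_pos (by have := hv.1; positivity) (hDpos v hv)
      have hm : 0 < 2 * l * (1 - v) / D v :=
        div_pos (mul_pos (by positivity) (sub_pos.mpr hv.2)) (hDpos v hv)
      rw [← h1p v hv] at hp
      rw [← h1m v hv] at hm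
      constructor <;> linarith
    · rintro ⟨ht1, ht2⟩
      have hE : 0 < τ * (1 - t) + l * (1 + t) :=
        add_pos (mul_pos hτ (by linarith)) (mul_pos hl (by linarith))
      have hv0 : 0 < l * (1 + t) := mul_pos hl (by linarith)
      have hv1 : 0 < τ * (1 - t) := mul_pos hτ (by linarith)
      have hv : l * (1 + t) / (τ * (1 - t) + l * (1 + t)) ∈ Set.Ioo (0 : ℝ) 1 :=
        ⟨div_pos hv0 hE, (div_lt_one hE).mpr (by linarith)⟩
      refine ⟨_, hv, ?_⟩
      have h3 := hDpos _ hv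
      simp only [hφ]
      rw [div_eq_iff h3.ne']
      simp only [hD]
      field_simp
      ring
  have hcv := integral_image_eq_integral_abs_deriv_smul measurableSet_Ioo hderiv hinj
    (fun t => (jacobiWeight α t : ℂ) * quadIntegrand τ (l : ℂ) t)
  rw [himage] at hcv
  have hint : ∀ v ∈ Set.Ioo (0 : ℝ) 1, |2 * τ * l / D v ^ 2| •
      ((jacobiWeight α (φ v) : ℂ) * quadIntegrand τ (l : ℂ) (φ v)) =
      ((2⁻¹ * l ^ (-α) * τ ^ (α - 1) : ℝ) : ℂ) * ((betaWeight α v : ℂ) * (v : ℂ) ^ 0) := by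
    intro v hv
    have hDv := hDpos v hv
    have hv0 := hv.1
    have hv1 : 0 < 1 - v := sub_pos.mpr hv.2
    have e3 : (2 : ℝ) ^ (-α) * 2 ^ (α - 1) = 2⁻¹ := by
      rw [← Real.rpow_add two_pos, show -α + (α - 1) = -1 by ring, Real.rpow_neg_one]
    have e4 : D v ^ (-α) * D v ^ (α - 1) = (D v)⁻¹ := by
      rw [← Real.rpow_add hDv, show -α + (α - 1) = -1 by ring, Real.rpow_neg_one]
    have n1 : D v ^ (-α) ≠ 0 := (Real.rpow_pos_of_pos hDv _).ne'
    have n2 : D v ^ (α - 1) ≠ 0 := (Real.rpow_pos_of_pos hDv _).ne'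
    have hw : jacobiWeight α (φ v) = 2⁻¹ * l ^ (-α) * τ ^ (α - 1) * betaWeight α v * D v := by
      rw [jacobiWeight, betaWeight, h1p v hv, h1m v hv, Real.div_rpow (by positivity) hDv.le,
        Real.div_rpow (by positivity) hDv.le, Real.mul_rpow (by positivity) hv1.le,
        Real.mul_rpow two_pos.le hl.le, Real.mul_rpow (by positivity) hv0.le,
        Real.mul_rpow two_pos.le hτ.le]
      rw [div_mul_div_comm, e4, div_inv_eq_mul, ← e3]
      ring
    have hq : quadIntegrand τ (l : ℂ) (φ v) = ((D v / (2 * τ * l) : ℝ) : ℂ) := by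
      rw [quadIntegrand, h1p v hv, h1m v hv, ← Complex.ofReal_add, ← Complex.ofReal_inv,
        ← Complex.ofReal_inv, ← Complex.ofReal_mul]
      congr 1
      rw [show τ * (2 * l * (1 - v) / D v) / (2 * τ * v / D v) + l = l / v by
        field_simp; ring]
      field_simp
    rw [hw, hq, abs_of_pos (by positivity), Complex.real_smul, ← Complex.ofReal_mul,
      ← Complex.ofReal_mul, pow_zero, mul_one, ← Complex.ofReal_mul]
    congr 1
    field_simp
  rw [setIntegral_congr_fun measurableSet_Ioo hint, integral_const_mul,
    ← integral_Ioc_eq_integral_Ioo, ← integral_Ioc_eq_integral_Ioo,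
    ← intervalIntegral.integral_of_le (by norm_num), ← intervalIntegral.integral_of_le zero_le_one,
    integral_betaWeight_mul_pow hα0 hα1] at hcv
  rw [hcv, jacobiMoment]
  simp only [Nat.factorial_zero, Nat.cast_one, inv_one, ascPochhammer_zero, eval_one, mul_one]
  rw [← Complex.ofReal_mul, ← Complex.ofReal_mul, ← Complex.ofReal_neg,
    ← Complex.ofReal_cpow hl.le, Complex.ofReal_inj, quadConst]
  have hs := (sin_mul_pi_pos hα0 hα1).ne'
  have hp := Real.pi_ne_zero
  have hττ : τ ^ (1 - α) * τ ^ (α - 1) = 1 := by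
    rw [← Real.rpow_add hτ, show 1 - α + (α - 1) = 0 by ring, Real.rpow_zero]
  field_simp
  linear_combination -hττ

/-! ### Gauss–Jacobi rules -/

theorem integral_jacobiWeight_mul_eval {α : ℝ} (hα0 : 0 < α) (hα1 : α < 1) (P : ℝ[X]) :
    ((∫ t in (-1 : ℝ)..1, jacobiWeight α t * P.eval t : ℝ) : ℂ) =
      ((Real.pi / Real.sin (α * Real.pi) : ℝ) : ℂ) *
        momentFunctional α ((P.map Complex.ofRealHom).comp (C 2 * X - 1)) := by
  rw [integral_jacobiWeight_mul, ← integral_betaWeight_mul_eval hα0 hα1,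
    ← intervalIntegral.integral_ofReal]
  congr 1
  funext s
  rw [Complex.ofReal_mul]
  congr 1
  rw [eval_comp, show (C 2 * X - 1 : ℂ[X]).eval (s : ℂ) = Complex.ofRealHom (2 * s - 1) by simp,
    eval_map, eval₂_at_apply, Complex.ofRealHom_eq_coe]

theorem natDegree_comp_two_mul_X_sub_one_le (P : ℂ[X]) :
    (P.comp (C 2 * X - 1)).natDegree ≤ P.natDegree := by
  have h : (C 2 * X - 1 : ℂ[X]).natDegree ≤ 1 := by compute_degree
  calc _ ≤ P.natDegree * (C 2 * X - 1 : ℂ[X]).natDegree := Polynomial.natDegree_comp_le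
    _ ≤ P.natDegree * 1 := Nat.mul_le_mul_left _ h
    _ = _ := mul_one _

/-- Interpolatory quadrature at the zeros of the orthogonal polynomial is exact up to degree
`2 k - 1`: a polynomial may be replaced by its remainder modulo the orthogonal polynomial. -/
theorem exists_isGaussJacobiRule {α : ℝ} (hα0 : 0 < α) (hα1 : α < 1) {k : ℕ} {Q : ℂ[X]}
    (hQ : Q.natDegree = k) (hQ0 : Q ≠ 0) (h : ∀ i < k, momentFunctional α (Q * X ^ i) = 0) :
    ∃ θ w : Fin k → ℝ, IsGaussJacobiRule α k θ w := by
  classical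
  have hcard : Q.roots.toFinset.card = k := by
    rw [Multiset.toFinset_card_of_nodup (nodup_roots_of_orthogonal hα0 hα1 hQ.le hQ0 h),
      ← hQ, ← (IsAlgClosed.splits Q).natDegree_eq_card_roots]
  let e := (Finset.equivFinOfCardEq hcard).symm
  have hroot : ∀ j, Q.eval ((e j : ℂ)) = 0 := fun j =>
    (mem_roots hQ0).mp (Multiset.mem_toFinset.mp (e j).2)
  have hreal := fun j => exists_mem_Ioo_of_eval_eq_zero hα0 hα1 hQ.le hQ0 h (hroot j)
  choose r hr hre using hreal
  have hinj : Function.Injective (fun j => (r j : ℂ)) := by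
    intro i j hij
    simp only [← hre] at hij
    exact e.injective (Subtype.ext hij)
  set ω : Fin k → ℂ := fun j =>
    momentFunctional α (Lagrange.basis Finset.univ (fun j => (r j : ℂ)) j) with hω
  have hexact : ∀ R : ℂ[X], R.natDegree < 2 * k →
      momentFunctional α R = ∑ j, ω j * R.eval (r j : ℂ) := by
    intro R hR
    have hk : 0 < k := by omega
    have hlow : ∀ B : ℂ[X], B.degree < k → momentFunctional α B = ∑ j, ω j * B.eval (r j : ℂ) := by
      intro B hB
      conv_lhs => rw [Lagrange.eq_interpolate_of_eval_eq (s := Finset.univ)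
        (v := fun j => (r j : ℂ)) (fun j => B.eval (r j : ℂ)) hinj.injOn (by simpa using hB)
        (fun _ _ => rfl), Lagrange.interpolate_apply, map_sum]
      refine sum_congr rfl fun j _ => ?_
      rw [← Polynomial.smul_eq_C_mul, map_smul, smul_eq_mul, mul_comm]
    have hdecomp := EuclideanDomain.div_add_mod R Q
    have hmod : (R % Q).degree < k := by
      rw [← hQ, ← degree_eq_natDegree hQ0]
      exact EuclideanDomain.mod_lt R hQ0
    have hdiv : (R / Q).natDegree < k := by
      rw [Polynomial.div_def]
      refine (natDegree_C_mul_le _ _).trans_lt ?_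
      rw [natDegree_divByMonic _ (monic_mul_leadingCoeff_inv hQ0),
        natDegree_mul_leadingCoeff_inv _ hQ0, hQ]
      omega
    conv_lhs => rw [← hdecomp, map_add, momentFunctional_mul_eq_zero h hdiv, zero_add, hlow _ hmod]
    refine sum_congr rfl fun j _ => ?_
    conv_rhs => rw [← hdecomp, eval_add, eval_mul, ← hre j, hroot j, zero_mul, zero_add, hre j]
  -- the `ω j` are in fact real; taking real parts avoids having to show it
  refine ⟨fun j => 2 * r j - 1, fun j => Real.pi / Real.sin (α * Real.pi) * (ω j).re, ?_, ?_, ?_⟩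
  · intro i j hij
    refine hinj ?_
    simp only at hij ⊢
    rw [show r i = r j by linarith]
  · intro j
    constructor <;> linarith [(hr j).1, (hr j).2]
  · intro P hP
    have h1 := integral_jacobiWeight_mul_eval hα0 hα1 P
    rw [hexact _ ((natDegree_comp_two_mul_X_sub_one_le _).trans_lt (natDegree_map_le.trans_lt hP))]
      at h1
    have h2 := congrArg Complex.re h1
    rw [Complex.ofReal_re, Complex.re_ofReal_mul, Complex.re_sum] at h2
    rw [h2, Finset.mul_sum]
    refine sum_congr rfl fun j _ => ?_
    rw [eval_comp, show (C 2 * X - 1 : ℂ[X]).eval (r j : ℂ) = Complex.ofRealHom (2 * r j - 1) by simp,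
      eval_map, eval₂_at_apply, Complex.ofRealHom_eq_coe, Complex.re_mul_ofReal]
    ring

/-- A Gauss–Jacobi rule, transported to `(0, 1)`, evaluates the moment functional on real
polynomials of degree less than `2 k`. -/
theorem IsGaussJacobiRule.momentFunctional_eq {α : ℝ} (hα0 : 0 < α) (hα1 : α < 1) {k : ℕ}
    {θ w : Fin k → ℝ} (h : IsGaussJacobiRule α k θ w) {S : ℝ[X]} (hS : S.natDegree < 2 * k) :
    momentFunctional α (S.map Complex.ofRealHom) =
      ∑ j, ((Real.sin (α * Real.pi) / Real.pi * w j : ℝ) : ℂ) *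
        ((S.eval ((1 + θ j) / 2) : ℝ) : ℂ) := by
  set P := S.comp (C (1 / 2 : ℝ) * (1 + X)) with hP
  have hdeg : P.natDegree < 2 * k := by
    refine lt_of_le_of_lt ?_ hS
    have h1 : (C (1 / 2 : ℝ) * (1 + X) : ℝ[X]).natDegree ≤ 1 := by compute_degree
    calc _ ≤ S.natDegree * (C (1 / 2 : ℝ) * (1 + X) : ℝ[X]).natDegree := natDegree_comp_le
      _ ≤ S.natDegree * 1 := Nat.mul_le_mul_left _ h1
      _ = _ := mul_one _
  have h1 := integral_jacobiWeight_mul_eval hα0 hα1 P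
  have h2 : (P.map Complex.ofRealHom).comp (C 2 * X - 1) = S.map Complex.ofRealHom := by
    rw [hP, Polynomial.map_comp, comp_assoc]
    conv_rhs => rw [← comp_X (p := S.map Complex.ofRealHom)]
    congr 1
    simp only [Polynomial.map_mul, Polynomial.map_add, map_C, Polynomial.map_one, map_X, mul_comp,
      C_comp, add_comp, one_comp, X_comp, add_sub_cancel]
    rw [← mul_assoc, ← C_mul]
    simp
  rw [h2, ← h.exact_of_lt P hdeg] at h1
  have hs : (Real.sin (α * Real.pi) : ℂ) ≠ 0 := by exact_mod_cast (sin_mul_pi_pos hα0 hα1).ne'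
  have hp : (Real.pi : ℂ) ≠ 0 := by exact_mod_cast Real.pi_ne_zero
  have h3 : momentFunctional α (S.map Complex.ofRealHom) =
      ((Real.sin (α * Real.pi) / Real.pi : ℝ) : ℂ) * ((∑ j, w j * P.eval (θ j) : ℝ) : ℂ) := by
    rw [h1]
    push_cast at hs ⊢
    field_simp
  rw [h3, ← Complex.ofReal_mul, Finset.mul_sum, Complex.ofReal_sum]
  refine sum_congr rfl fun j _ => ?_
  rw [← Complex.ofReal_mul, hP, eval_comp]
  congr 1
  rw [show (C (1 / 2 : ℝ) * (1 + X) : ℝ[X]).eval (θ j) = (1 + θ j) / 2 by simp; ring]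
  ring

/-- The nodes of a Gauss–Jacobi rule are the zeros of the orthogonal polynomial. -/
theorem IsGaussJacobiRule.eval_node_eq_zero {α : ℝ} (hα0 : 0 < α) (hα1 : α < 1) {k : ℕ}
    {θ w : Fin k → ℝ} (h : IsGaussJacobiRule α k θ w) {Q : ℂ[X]} (hQ : Q.natDegree ≤ k)
    (hQo : ∀ i < k, momentFunctional α (Q * X ^ i) = 0) (j : Fin k) :
    Q.eval (((1 + θ j) / 2 : ℝ) : ℂ) = 0 := by
  -- the rule gives zero on multiples of the node polynomial `N`, so exactness makes `N` orthogonal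
  set N : ℝ[X] := ∏ j, (X - C ((1 + θ j) / 2)) with hN
  have hmonic : N.Monic := monic_prod_of_monic _ _ fun j _ => monic_X_sub_C _
  have hdeg : N.natDegree = k := by
    rw [hN, natDegree_prod_of_monic _ _ fun j _ => monic_X_sub_C _]
    simp
  have hroot : ∀ j, N.eval ((1 + θ j) / 2) = 0 := fun j => by
    rw [hN, eval_prod]
    exact Finset.prod_eq_zero (Finset.mem_univ j) (by simp)
  have horth : ∀ i < k, momentFunctional α (N.map Complex.ofRealHom * X ^ i) = 0 := by
    intro i hi
    have h1 := h.momentFunctional_eq hα0 hα1 (S := N * X ^ i) (by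
      rw [hmonic.natDegree_mul (monic_X_pow i), hdeg, natDegree_X_pow]
      omega)
    rw [Polynomial.map_mul, Polynomial.map_pow, map_X] at h1
    rw [h1]
    exact Finset.sum_eq_zero fun j _ => by rw [eval_mul, hroot, zero_mul]; simp
  have hmap : (N.map Complex.ofRealHom).natDegree = k := by
    rw [natDegree_map_eq_of_injective Complex.ofReal_injective, hdeg]
  have hk : (N.map Complex.ofRealHom).coeff k ≠ 0 := by
    rw [coeff_map, ← hdeg, coeff_natDegree, hmonic.leadingCoeff]
    simp
  rw [eq_C_mul_of_orthogonal hα0 hα1 hmap.le hk horth hQ hQo, eval_mul,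
    ← Complex.ofRealHom_eq_coe, eval_map, eval₂_at_apply, hroot j, map_zero, mul_zero]

/-! ### Continuation of the remainder -/

theorem inv_notMem_Ioo_of_mem_cutPlane {z : ℂ} (hz : z ∈ cutPlane) {r : ℝ}
    (hr : r ∈ Set.Ioo (0 : ℝ) 1) : z⁻¹ ≠ r := by
  intro h
  have h1 : z = ((r⁻¹ : ℝ) : ℂ) := by rw [← inv_inv z, h]; push_cast; rfl
  have h2 : 1 < r⁻¹ := (one_lt_inv₀ hr.1).mpr hr.2
  rw [cutPlane, Set.mem_ofPred_eq, h1, ← Complex.ofReal_one, ← Complex.ofReal_sub,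
    Complex.ofReal_mem_slitPlane] at hz
  linarith

theorem isOpen_cutPlane : IsOpen cutPlane :=
  Complex.isOpen_slitPlane.preimage (continuous_const.sub continuous_id)

theorem hyp2F1_neg_natCast (k : ℕ) (a z : ℂ) :
    hyp2F1 (-(k : ℂ)) k a z = (jacobiPoly a k).eval z := by
  rw [hyp2F1, if_pos ⟨k, Or.inl rfl⟩, eval_jacobiPoly]

theorem neg_natCast_ne_of_re_pos {a : ℂ} (ha : 0 < a.re) (n : ℕ) : a ≠ -(n : ℂ) := by
  rintro rfl
  simp only [Complex.neg_re, Complex.natCast_re] at ha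
  linarith [n.cast_nonneg (α := ℝ)]

theorem radius_ordinaryHypergeometricSeries {a b c : ℂ} (ha : 0 < a.re) (hb : 0 < b.re)
    (hc : 0 < c.re) : (ordinaryHypergeometricSeries ℂ a b c).radius = 1 := by
  have h : ∀ {x : ℂ}, 0 < x.re → ∀ n : ℕ, (n : ℂ) ≠ -x := fun hx n hn =>
    neg_natCast_ne_of_re_pos hx n (by rw [hn, neg_neg])
  exact ordinaryHypergeometricSeries_radius_eq_one ℂ a b c fun n => ⟨h ha n, h hb n, h hc n⟩

theorem differentiableOn_ordinaryHypergeometric {a b c : ℂ} (ha : 0 < a.re) (hb : 0 < b.re)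
    (hc : 0 < c.re) : DifferentiableOn ℂ (ordinaryHypergeometric a b c) (Metric.ball (0 : ℂ) 1) := by
  have hr := radius_ordinaryHypergeometricSeries ha hb hc
  have h := (ordinaryHypergeometricSeries ℂ a b c).hasFPowerSeriesOnBall (by rw [hr]; exact one_pos)
  have h2 := h.differentiableOn
  rw [hr, ← ENNReal.ofReal_one, Metric.eball_ofReal] at h2
  exact h2

/-- To continue the Gauss series it suffices to have a holomorphic function `G` on the cut plane
which agrees on the disc with the series times a power of `z`. -/
theorem hyp2F1_eq_of_pow_mul {a b c : ℂ} (ha : 0 < a.re) (hb : 0 < b.re) (hc : 0 < c.re) {N : ℕ}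
    {G : ℂ → ℂ} (hG : DifferentiableOn ℂ G cutPlane)
    (h : ∀ z : ℂ, ‖z‖ < 1 → G z = z ^ N * ordinaryHypergeometric a b c z) {z : ℂ}
    (hz : z ∈ cutPlane) : G z = z ^ N * hyp2F1 a b c z := by
  classical
  set F : ℂ → ℂ := fun z => if ‖z‖ < 1 then ordinaryHypergeometric a b c z else G z / z ^ N with hF
  have hF1 : ∀ z : ℂ, z ≠ 0 → F z = G z / z ^ N := by
    intro z hz
    simp only [hF]
    split_ifs with h1
    · rw [h z h1, mul_div_cancel_left₀ _ (pow_ne_zero N hz)]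
    · rfl
  have hbranch : IsHypergeometricBranch a b c F := by
    refine ⟨fun z hz => ?_, fun z hz => if_pos hz⟩
    refine DifferentiableAt.differentiableWithinAt ?_
    by_cases h0 : z = 0
    · have hnhds : Metric.ball (0 : ℂ) 1 ∈ 𝓝 z := by
        rw [h0]; exact Metric.ball_mem_nhds 0 one_pos
      refine ((differentiableOn_ordinaryHypergeometric ha hb hc).differentiableAt
        hnhds).congr_of_eventuallyEq ?_
      filter_upwards [hnhds] with y hy
      exact if_pos (by simpa using hy)
    · refine ((hG.differentiableAt (isOpen_cutPlane.mem_nhds hz)).div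
        (differentiableAt_id.pow N) (pow_ne_zero N h0)).congr_of_eventuallyEq ?_
      filter_upwards [isOpen_ne.mem_nhds h0] with y hy
      exact hF1 y hy
  have hhyp : hyp2F1 a b c z = F z := by
    rw [hyp2F1, if_neg]
    · exact (Classical.epsilon_spec (p := IsHypergeometricBranch a b c) ⟨F, hbranch⟩).eqOn
        hbranch hz
    · rintro ⟨n, hn | hn⟩
      · exact neg_natCast_ne_of_re_pos ha n hn
      · exact neg_natCast_ne_of_re_pos hb n hn
  rw [hhyp]
  by_cases h0 : z = 0
  · have h1 : ‖z‖ < 1 := by simp [h0]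
    rw [h z h1, hbranch.2 z h1]
  · rw [hF1 z h0, mul_div_cancel₀ _ (pow_ne_zero N h0)]

/-- The remainder of the canonical Padé pair, cleared of denominators. -/
theorem remainder_eq {α : ℝ} (hα0 : 0 < α) (hα1 : α < 1) {k : ℕ} (hk : 1 ≤ k) {z : ℂ}
    (hz : z ∈ cutPlane) :
    (1 - z) ^ (-(α : ℂ)) * (reflect k (jacobiPoly α k)).eval z -
        (padeNumerator α k (jacobiPoly α k)).eval z =
      momentFunctional α (jacobiPoly α k * X ^ k) *
        (z ^ (2 * k) * hyp2F1 ((k : ℂ) + 1) ((k : ℂ) + α) (2 * (k : ℂ) + 1) z) := by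
  have ha := ofReal_add_nat_ne_zero hα0
  set P := jacobiPoly (α : ℂ) k with hP
  set I := momentFunctional (α : ℂ) (P * X ^ k) with hI
  set G : ℂ → ℂ := fun z => (1 - z) ^ (-(α : ℂ)) * (reflect k P).eval z -
    (padeNumerator α k P).eval z with hG
  have hI0 : I ≠ 0 := by
    rw [hI, hP, momentFunctional_jacobiPoly_self ha hk]
    refine div_ne_zero (mul_ne_zero (mul_ne_zero (pow_ne_zero _ (by norm_num)) ?_)
      (by exact_mod_cast k.factorial_ne_zero)) (by exact_mod_cast (2 * k).factorial_ne_zero)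
    rw [Ne, ascPochhammer_eval_eq_zero_iff]
    rintro ⟨n, _, hn⟩
    exact neg_natCast_ne_of_re_pos (a := 1 - (α : ℂ)) (by simpa using hα1) n
      (by rw [hn, neg_neg])
  have hk0 : (0 : ℝ) < k := by exact_mod_cast hk
  have hseries : ∀ z : ℂ, ‖z‖ < 1 → I⁻¹ * G z = z ^ (2 * k) *
      ordinaryHypergeometric ((k : ℂ) + 1) ((k : ℂ) + α) (2 * (k : ℂ) + 1) z := by
    intro z hz
    have h1 := hasSum_momentFunctional (α : ℂ) (natDegree_jacobiPoly_le (α : ℂ) k) hz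
    rw [← hP, ← hasSum_nat_add_iff' k, Finset.sum_eq_zero, sub_zero] at h1
    · have h2 := h1.tsum_eq
      simp only [hG]
      simp only [ordinaryHypergeometric_eq_tsum]
      rw [← h2, ← tsum_mul_left, ← tsum_mul_left]
      refine tsum_congr fun n => ?_
      rw [hP, momentFunctional_jacobiPoly_add ha, ← hP, ← hI, smul_eq_mul,
        show n + k + k = 2 * k + n by ring, pow_add]
      field_simp
    · intro i hi
      rw [hP, momentFunctional_jacobiPoly_eq_zero ha (mem_range.mp hi), zero_mul]
  have hdiff : DifferentiableOn ℂ (fun z => I⁻¹ * G z) cutPlane := by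
    intro z hz
    refine DifferentiableAt.differentiableWithinAt ?_
    have hz' : 1 - z ∈ Complex.slitPlane := hz
    refine DifferentiableAt.const_mul ?_ _
    refine DifferentiableAt.sub (DifferentiableAt.mul ?_ (Polynomial.differentiable _ _))
      (Polynomial.differentiable _ _)
    exact ((differentiableAt_const _).sub differentiableAt_id).cpow (differentiableAt_const _) hz'
  have h := hyp2F1_eq_of_pow_mul (by simp; positivity) (by simp; positivity) (by simp; positivity)
    hdiff hseries hz
  rw [← h, mul_inv_cancel_left₀ hI0]

theorem Gamma_constant {α : ℝ} (hα1 : α < 1) (k : ℕ) :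
    ((Real.Gamma ((k : ℝ) + 1 - α) * Real.Gamma ((k : ℝ) + 1) /
      (Real.Gamma (1 - α) * Real.Gamma (2 * (k : ℝ) + 1)) : ℝ) : ℂ) =
    (ascPochhammer ℂ k).eval (1 - (α : ℂ)) * k.factorial / (2 * k).factorial := by
  have h1 : ∀ n : ℕ, (1 - (α : ℂ)) + n ≠ 0 := by
    intro n
    have := ofReal_add_nat_ne_zero (α := 1 - α) (by linarith) n
    simpa using this
  have h2 := Gamma_add_nat h1 k
  have h3 : Complex.Gamma (1 - (α : ℂ)) ≠ 0 :=
    Complex.Gamma_ne_zero_of_re_pos (by simpa using hα1)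
  rw [Real.Gamma_nat_eq_factorial, show (2 * (k : ℝ) + 1) = ((2 * k : ℕ) : ℝ) + 1 by push_cast; rfl,
    Real.Gamma_nat_eq_factorial, show (k : ℝ) + 1 - α = (1 - α) + k by ring]
  push_cast [← Complex.Gamma_ofReal]
  rw [h2]
  field_simp

theorem coeff_jacobiPoly_self_ne_zero {a : ℂ} (ha : ∀ n : ℕ, a + n ≠ 0) (k : ℕ) :
    (jacobiPoly a k).coeff k ≠ 0 := by
  rw [coeff_jacobiPoly, ordinaryHypergeometricCoefficient]
  refine mul_ne_zero (mul_ne_zero (mul_ne_zero ?_ ?_) ?_) (inv_ne_zero ?_)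
  · exact inv_ne_zero (by exact_mod_cast k.factorial_ne_zero)
  · rw [Ne, ascPochhammer_eval_eq_zero_iff]
    rintro ⟨n, hn, h⟩
    rw [neg_neg, Nat.cast_inj] at h
    omega
  · rw [Ne, ascPochhammer_eval_eq_zero_iff]
    rintro ⟨n, hn, h⟩
    have : n + k = 0 := by exact_mod_cast eq_neg_iff_add_eq_zero.mp h
    omega
  · rw [Ne, ascPochhammer_eval_eq_zero_iff]
    rintro ⟨n, _, h⟩
    exact ha n (by rw [h]; ring)

/-! ### The Padé approximant, its error and its quadrature form -/

theorem mainTheorem2 (α : ℝ) (hα0 : 0 < α) (hα1 : α < 1) (k : ℕ) (hk : 1 ≤ k) :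
    -- the `(k-1, k)`-Padé approximant of `w ^ (-α)` centred at `w = 1` exists
    (∃ p q : ℂ[X], IsPadePair (fun w : ℂ => w ^ (-(α : ℂ))) 1 (k - 1) k p q) ∧
    -- the `k`-point Gauss–Jacobi rule exists
    (∃ θ w : Fin k → ℝ, IsGaussJacobiRule α k θ w) ∧
    -- the integral representation of `l ^ (-α)`
    (∀ τ : ℝ, 0 < τ → ∀ l : ℝ, 0 < l →
      (l : ℂ) ^ (-(α : ℂ)) =
        (quadConst α τ : ℂ) *
          ∫ t in (-1 : ℝ)..1, (jacobiWeight α t : ℂ) * quadIntegrand τ (l : ℂ) t) ∧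
    ∀ p q : ℂ[X], IsPadePair (fun w : ℂ => w ^ (-(α : ℂ))) 1 (k - 1) k p q →
      -- the truncation error, with `R = p / q` and `w = 1 - z`
      (∀ z : ℂ, z ∈ cutPlane → z ≠ 0 →
        q.eval (1 - z) ≠ 0 ∧
        hyp2F1 (-(k : ℂ)) (k : ℂ) (α : ℂ) z⁻¹ ≠ 0 ∧
        (1 - z) ^ (-(α : ℂ)) - p.eval (1 - z) / q.eval (1 - z) =
          ((Real.Gamma ((k : ℝ) + 1 - α) * Real.Gamma ((k : ℝ) + 1) /
              (Real.Gamma (1 - α) * Real.Gamma (2 * (k : ℝ) + 1)) : ℝ) : ℂ) *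
            (hyp2F1 ((k : ℂ) + 1) ((k : ℂ) + (α : ℂ)) (2 * (k : ℂ) + 1) z /
              hyp2F1 (-(k : ℂ)) (k : ℂ) (α : ℂ) z⁻¹) *
            (-z) ^ k) ∧
      -- `R` is what the Gauss–Jacobi quadrature of the integral representation produces
      (∀ τ : ℝ, 0 < τ → ∀ θ w : Fin k → ℝ, IsGaussJacobiRule α k θ w →
        ∀ l : ℂ, l ∈ Complex.slitPlane →
          quadRational α τ θ w l =
            ((τ ^ (-α) : ℝ) : ℂ) * (p.eval (l / (τ : ℂ)) / q.eval (l / (τ : ℂ)))) := by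
  have ha := ofReal_add_nat_ne_zero hα0
  set P := jacobiPoly (α : ℂ) k with hP
  have hPd : P.natDegree ≤ k := natDegree_jacobiPoly_le _ k
  have hPk : P.coeff k ≠ 0 := coeff_jacobiPoly_self_ne_zero ha k
  have hP0 : P ≠ 0 := by
    intro h
    rw [h] at hPk
    simp at hPk
  have hPo : ∀ i < k, momentFunctional (α : ℂ) (P * X ^ i) = 0 := fun i hi =>
    momentFunctional_jacobiPoly_eq_zero ha hi
  refine ⟨⟨_, _, isPadePair_of_orthogonal hk hPd hPk hPo⟩,
    exists_isGaussJacobiRule hα0 hα1 (hPd.antisymm (le_natDegree_of_ne_zero hPk)) hP0 hPo,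
    fun τ hτ l hl => integral_jacobiWeight_mul_quadIntegrand hα0 hα1 hτ hl, fun p q hpq => ?_⟩
  obtain ⟨hpQ, hQo⟩ := hpq.orthogonal hk
  set Q := reflect k (q.comp (1 - X)) with hQ
  have hqd : (q.comp (1 - X)).natDegree ≤ k :=
    (natDegree_comp_one_sub_X_le q).trans hpq.natDegree_den_le
  have hQd : Q.natDegree ≤ k := natDegree_reflect_le_of_le hqd
  have hQQ : reflect k Q = q.comp (1 - X) := by
    ext n
    rw [hQ, coeff_reflect, coeff_reflect, Polynomial.revAt_invol]
  have hp : ∀ z : ℂ, p.eval (1 - z) = (padeNumerator α k Q).eval z := fun z => by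
    rw [← hpQ]; simp
  have hq : ∀ z : ℂ, q.eval (1 - z) = (reflect k Q).eval z := fun z => by
    rw [hQQ]; simp
  have hQ0 : Q ≠ 0 := by
    intro h
    have := hpq.den_ne_zero
    rw [← sub_zero (1 : ℂ), hq, h] at this
    simp at this
  -- zeros of an orthogonal polynomial lie in `(0, 1)`, so their inverses lie on the cut
  have hne : ∀ z ∈ cutPlane, ∀ R : ℂ[X], R.natDegree ≤ k → R ≠ 0 →
      (∀ i < k, momentFunctional (α : ℂ) (R * X ^ i) = 0) → R.eval z⁻¹ ≠ 0 := by
    intro z hz R hRd hR0 hRo h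
    obtain ⟨r, hr, hzr⟩ := exists_mem_Ioo_of_eval_eq_zero hα0 hα1 hRd hR0 hRo h
    exact inv_notMem_Ioo_of_mem_cutPlane hz hr hzr
  have hqne : ∀ z ∈ cutPlane, q.eval (1 - z) ≠ 0 := by
    intro z hz
    by_cases h0 : z = 0
    · simpa [h0] using hpq.den_ne_zero
    · rw [hq, eval_reflect_of_ne_zero hQd h0]
      exact mul_ne_zero (pow_ne_zero _ h0) (hne z hz Q hQd hQ0 hQo)
  refine ⟨fun z hz hz0 => ⟨hqne z hz, ?_, ?_⟩, fun τ hτ θ w hrule l hl => ?_⟩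
  · rw [hyp2F1_neg_natCast]
    exact hne z hz P hPd hP0 hPo
  · have hPz := hne z hz P hPd hP0 hPo
    obtain ⟨c, hc⟩ : ∃ c : ℂ, Q = C c * P :=
      ⟨_, eq_C_mul_of_orthogonal hα0 hα1 hPd hPk hPo hQd hQo⟩
    have hc0 : c ≠ 0 := by
      rintro rfl
      exact hQ0 (by rw [hc, C_0, zero_mul])
    have hrem := remainder_eq hα0 hα1 hk hz
    rw [← hP, eval_reflect_of_ne_zero hPd hz0, hP, momentFunctional_jacobiPoly_self ha hk,
      ← hP] at hrem
    rw [hp, hq, Gamma_constant hα1, hyp2F1_neg_natCast, ← hP, hc, padeNumerator_C_mul,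
      reflect_C_mul, eval_mul, eval_mul, eval_C, mul_div_mul_left _ _ hc0,
      eval_reflect_of_ne_zero hPd hz0]
    have hzk : z ^ k ≠ 0 := pow_ne_zero k hz0
    apply mul_right_cancel₀ (mul_ne_zero hzk hPz)
    rw [sub_mul, div_mul_cancel₀ _ (mul_ne_zero hzk hPz), hrem, neg_pow z k, two_mul k, pow_add]
    generalize P.eval z⁻¹ = y at hPz ⊢
    field_simp
  · have hτ' : (τ : ℂ) ≠ 0 := by exact_mod_cast hτ.ne'
    set z : ℂ := 1 - l / τ with hz
    have hzl : 1 - z = l / τ := by rw [hz]; ring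
    have hzcut : z ∈ cutPlane := by
      rw [cutPlane, Set.mem_ofPred_eq, hzl, div_eq_mul_inv, mul_comm, ← Complex.ofReal_inv]
      rw [Complex.mem_slitPlane_iff] at hl ⊢
      rw [Complex.re_ofReal_mul, Complex.im_ofReal_mul]
      have : 0 < τ⁻¹ := inv_pos.mpr hτ
      exact hl.imp (mul_pos this) (mul_ne_zero this.ne')
    have hnode := hrule.eval_node_eq_zero hα0 hα1 hQd hQo
    have hmom : ∀ n < k, ∑ j, ((Real.sin (α * Real.pi) / Real.pi * w j : ℝ) : ℂ) *
        (((1 + θ j) / 2 : ℝ) : ℂ) ^ n = jacobiMoment α n := by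
      intro n hn
      have h1 := hrule.momentFunctional_eq hα0 hα1 (S := X ^ n)
        (by rw [natDegree_X_pow]; omega)
      rw [Polynomial.map_pow, map_X, momentFunctional_X_pow] at h1
      rw [h1]
      refine sum_congr rfl fun j _ => ?_
      rw [eval_pow, eval_X, Complex.ofReal_pow]
    have hker : ∀ j, 1 - z * (((1 + θ j) / 2 : ℝ) : ℂ) ≠ 0 := by
      intro j h
      have hs := hrule.mem_Ioo j
      have h1 : z⁻¹ = (((1 + θ j) / 2 : ℝ) : ℂ) := by
        rw [sub_eq_zero, eq_comm] at h
        exact inv_eq_of_mul_eq_one_right h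
      exact inv_notMem_Ioo_of_mem_cutPlane hzcut
        ⟨by linarith [hs.1], by linarith [hs.2]⟩ h1
    have hquad := eval_padeNumerator_of_quadrature hQd hnode hmom hker
    rw [← hzl, hp, hquad, ← hq, mul_div_cancel_left₀ _ (hqne z hzcut), quadRational,
      Finset.mul_sum, Finset.mul_sum]
    refine sum_congr rfl fun j _ => ?_
    have hs := hrule.mem_Ioo j
    have h1 : ((1 + θ j : ℝ) : ℂ) ≠ 0 := by
      exact_mod_cast (show 1 + θ j ≠ 0 by linarith [hs.1])
    have hk2 : quadIntegrand τ l (θ j) =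
        (2 * (τ : ℂ))⁻¹ * (1 - z * (((1 + θ j) / 2 : ℝ) : ℂ))⁻¹ := by
      rw [quadIntegrand, ← mul_inv, ← mul_inv, hz]
      congr 1
      push_cast at h1 ⊢
      field_simp
      ring
    have hττ : τ ^ (1 - α) = τ * τ ^ (-α) := by
      rw [sub_eq_add_neg, Real.rpow_add hτ, Real.rpow_one]
    rw [hk2, quadConst, hττ]
    have hpi : (Real.pi : ℂ) ≠ 0 := by exact_mod_cast Real.pi_ne_zero
    push_cast
    field_simp
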